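/- **Conventions.** $\le_T$, $\equiv_T$ denote Turing reducibility and equivalence; sets of natural numbers are identified with their characteristic functions. *Borel codes.* A real $c\in\omega^\omega$ is a code for a Borel set $B\subseteq\omega^\omega$ according to the following (well-founded) recursion: if $c(0)\ge 2$, then $c$ codes $\bigcup\{[s_n] : c(n+1)=1\}$, where $\langle s_n\rangle$ is a fixed computable enumeration of $\omega^{<\omega}$ and $[s]=\{x: s\sqsubset x\}$; if $c(0)=0$ and $n\mapsto c(n+1)$ codes $B$, then $c$ codes $\omega^\omega\setminus B$; if $c(0)=1$ and $n\mapsto c(\langle i,n\rangle+1)$ codes $B_i$ for every $i\in\omega$, then $c$ codes $\bigcup_i B_i$. A code for $j:\omega^\omega\to 2$ is a code for $\{x: j(x)=1\}$; a code for $g:\omega^\omega\to 2^\omega$ is a $c$ such that, for every $i$, $n\mapsto c(\langle i,n\rangle)$ is a code for $x\mapsto g(x)(i)$. *The class $\Sigma^2_1(c)$.* For $a,c\in\omega^\omega$, $a\in\Sigma^2_1(c)$ means that the relation $a(n)=m$ is defined by a formula $(\exists X\subseteq\omega^\omega)\,\varphi(X,n,m,c)$ in which $\varphi$ is a formula of arithmetic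 with quantifiers over $\omega$ and over $\omega^\omega$ only. *The encoding function.* Let $a\in\omega^\omega$. Let $A\subseteq\omega$ be an infinite set such that $A\equiv_T a$ and $A\le_T B$ for every infinite $B\subseteq A$; let $\eta:A\to 2$ be such that $\eta^{-1}(0)$ and $\eta^{-1}(1)$ are infinite. Let $f_a:\omega^\omega\to 2^\omega$ be a function such that $f_a(x)=\langle\eta(x_{i_0}),\eta(x_{i_1}),\dots\rangle$ whenever the set of indices $i$ with $x_i\in A$ is infinite and is enumerated increasingly by $i_0<i_1<\cdots$ (the values at all other $x$ are arbitrary). *The games.* Let $\mathbb H$ be the set of pairs $(t,h)$ with $t\in\omega^{<\omega}$ and $h:\omega^{<\omega}\to\omega$. Write $(t_2,h_2)\le(t_1,h_1)$ if $t_2\sqsupseteq t_1$, $t_2(n)\ge h_1(t_2\restriction n)$ for all $n\in\mathrm{dom}(t_2)\setminus\mathrm{dom}(t_1)$, and $h_2\ge h_1$ pointwise; write $(t_2,h_2)\le^A(t_1,h_1)$ if moreover $t_2(n)\notin A$ for all such $n$. For $j:\omega^\omega\to 2$ and $m\in 2$, a pair $p\in\mathbb H$ *ensures* $j(x)=m$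 if Player II has a winning strategy in the following game of length $\omega$ with starting position $p$: the players alternate, Player I first; Player I plays a pair that is $\le$ the current pair, Player II plays a pair that is $\le^A$ the current pair; Player II wins iff the union $x$ of the first coordinates of the pairs played is an element of $\omega^\omega$ and $j(x)=m$. **Theorem.** Let $a$, $A$, $\eta$, $f_a$ be as above, let $g:\omega^\omega\to 2^\omega$ be Borel, and let $c$ be a code for $g$. 1. If for every $i\in\omega$ and every $(t,h)\in\mathbb H$ there are $m\in 2$ and $(t',h')\le^A(t,h)$ which ensures $g(x)(i)=m$, then there is $x\in\omega^\omega$ with $f_a(x)=g(x)$. 2. If $a\notin\Sigma^2_1(c)$, then for every Borel $j:\omega^\omega\to 2$ that has a code computable from $c$ and every $(t,h)\in\mathbb H$ there are $m\in 2$ and $(t',h')\le^A(t,h)$ which ensures $j(x)=m$. 3. If $a\notin\Sigma^2_1(c)$, then there is $x\in\omega^\omega$ with $f_a(x)=g(x)$. 4. Hence, if $f_a(x)\ne g(x)$ for all $x\in\omega^\omega$, then $a\in\Sigma^2_1(c)$. -/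

import Mathlib

open scoped Computability

namespace Encoding

/-! ### Baire space, Cantor space, finite sequences -/

/-- Baire space `ω^ω`. -/
abbrev Baire : Type := ℕ → ℕ

/-- Cantor space `2^ω`. -/
abbrev Cantor : Type := ℕ → Fin 2

/-- The finite sequence `t` is an initial segment of `x`. -/
def IsInit (t : List ℕ) (x : Baire) : Prop :=
  ∀ i (hi : i < t.length), t[i] = x i

/-! ### Turing reducibility for sets and the encoding functions -/

open Classical in
/-- The characteristic function of a set of natural numbers. -/
noncomputable def charFun (A : Set ℕ) : Baire :=
  fun n => if n ∈ A then 1 else 0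

/-- `A` is an infinite set of natural numbers that is Turing equivalent to `a` and is computable
from each of its infinite subsets. -/
structure IsCodingSet (a : Baire) (A : Set ℕ) : Prop where
  infinite : A.Infinite
  turingEquivalent : (charFun A : ℕ →. ℕ) ≡ᵀ (a : ℕ →. ℕ)
  le_subset : ∀ B : Set ℕ, B ⊆ A → B.Infinite → (charFun A : ℕ →. ℕ) ≤ᵀ (charFun B : ℕ →. ℕ)

/-- `f` is an encoding function built from `A` and `η : A → 2`: if `i₀ < i₁ < ⋯` are the indices
`i` with `x i ∈ A`, and there are infinitely many of them, then
`f x = ⟨η (x i₀), η (x i₁), …⟩`. The values of `f` at the remaining `x` are arbitrary. -/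
def IsEncodingFun (A : Set ℕ) (η : A → Fin 2) (f : Baire → Cantor) : Prop :=
  ∀ x : Baire, {i | x i ∈ A}.Infinite →
    ∀ k, ∃ hk : x (Nat.nth (fun i => x i ∈ A) k) ∈ A, f x k = η ⟨_, hk⟩

/-! ### Borel codes -/

/-- `BorelCode c B`: the real `c` is a code for the Borel set `B ⊆ ω^ω`.
A code is a well-founded description of `B`: the first digit tells whether `B` is given
as a union of basic open sets, as a complement, or as a countable union. -/
inductive BorelCode : Baire → Set Baire → Prop
  | isOpen (c : Baire) (h : 2 ≤ c 0) :
      BorelCode c {x | ∃ n, c (n + 1) = 1 ∧ IsInit (Denumerable.ofNat (List ℕ) n) x}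
  | compl (c : Baire) (B : Set Baire) (h : c 0 = 0)
      (hB : BorelCode (fun n => c (n + 1)) B) : BorelCode c Bᶜ
  | iUnion (c : Baire) (B : ℕ → Set Baire) (h : c 0 = 1)
      (hB : ∀ i, BorelCode (fun n => c (Nat.pair i n + 1)) (B i)) : BorelCode c (⋃ i, B i)

/-- `c` is a code for the Borel function `j : ω^ω → 2`. -/
def IsCodeTwo (c : Baire) (j : Baire → Fin 2) : Prop :=
  BorelCode c {x | j x = 1}

/-- `c` is a code for the Borel function `g : ω^ω → 2^ω`: the `i`-th row of `c` is a code for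
the `i`-th coordinate of `g`. -/
def IsCode (c : Baire) (g : Baire → Cantor) : Prop :=
  ∀ i, IsCodeTwo (fun n => c (Nat.pair i n)) (fun x => g x i)

/-! ### The pointclass `Σ²₁(c)`

Formulas of arithmetic with variables for natural numbers and for elements of `ω^ω` (both
indexed by de Bruijn indices), and with one third-order variable `X ⊆ ω^ω`. -/

/-- Terms denoting natural numbers; `app k t` is the `k`-th real variable applied to `t`. -/
inductive NumTerm : Type
  | var (k : ℕ)
  | zero
  | succ (t : NumTerm)
  | add (s t : NumTerm)
  | mul (s t : NumTerm)
  | app (k : ℕ) (t : NumTerm)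

/-- Formulas whose quantifiers range over natural numbers and over reals;
`mem k` says that the `k`-th real variable belongs to `X`. -/
inductive Formula : Type
  | eq (s t : NumTerm)
  | mem (k : ℕ)
  | neg (φ : Formula)
  | and (φ ψ : Formula)
  | exNum (φ : Formula)
  | exReal (φ : Formula)

/-- Put a new value in front of an assignment. -/
def push {α : Type} (b : α) (v : ℕ → α) : ℕ → α
  | 0 => b
  | k + 1 => v k

/-- The value of a term at the assignments `v` (numbers) and `r` (reals). -/
def NumTerm.val (v : ℕ → ℕ) (r : ℕ → Baire) : NumTerm → ℕ
  | .var k => v k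
  | .zero => 0
  | .succ t => t.val v r + 1
  | .add s t => s.val v r + t.val v r
  | .mul s t => s.val v r * t.val v r
  | .app k t => r k (t.val v r)

/-- Satisfaction in the standard structure. -/
def Formula.Sat (X : Set Baire) : Formula → (ℕ → ℕ) → (ℕ → Baire) → Prop
  | .eq s t, v, r => s.val v r = t.val v r
  | .mem k, _, r => r k ∈ X
  | .neg φ, v, r => ¬ φ.Sat X v r
  | .and φ ψ, v, r => φ.Sat X v r ∧ ψ.Sat X v r
  | .exNum φ, v, r => ∃ n : ℕ, φ.Sat X (push n v) r
  | .exReal φ, v, r => ∃ x : Baire, φ.Sat X v (push x r)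

/-- `a ∈ Σ²₁(c)`: the relation `a n = m` is defined by a formula `∃ X ⊆ ω^ω, φ(X, n, m, c)`
in which `φ` quantifies over numbers and reals only. Unused variables have value `0`. -/
def Sigma21 (c a : Baire) : Prop :=
  ∃ φ : Formula, ∀ n m : ℕ,
    a n = m ↔ ∃ X : Set Baire, φ.Sat X (push n (push m 0)) (push c 0)

/-! ### The poset `ℍ` and the games -/

/-- `t₂` is an extension of `t₁` to the right of `h`. -/
def RightExt (h : List ℕ → ℕ) (t₂ t₁ : List ℕ) : Prop :=
  t₁ <+: t₂ ∧ ∀ n (hn : n < t₂.length), t₁.length ≤ n → h (t₂.take n) ≤ t₂[n]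

/-- `t₂` is an extension of `t₁` all of whose new values are outside `A`. -/
def AvoidExt (A : Set ℕ) (t₂ t₁ : List ℕ) : Prop :=
  t₁ <+: t₂ ∧ ∀ n (hn : n < t₂.length), t₁.length ≤ n → t₂[n] ∉ A

/-- The conditions `(t, h)` of the poset `ℍ`. -/
structure Cond : Type where
  stem : List ℕ
  bound : List ℕ → ℕ

/-- `q ≤ p` in `ℍ`. -/
def Cond.Le (q p : Cond) : Prop :=
  RightExt p.bound q.stem p.stem ∧ ∀ t, p.bound t ≤ q.bound t

/-- `q ≤^A p`. -/
def Cond.LeA (A : Set ℕ) (q p : Cond) : Prop :=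
  RightExt p.bound q.stem p.stem ∧ AvoidExt A q.stem p.stem ∧ ∀ t, p.bound t ≤ q.bound t

/-- Player II's `k`-th reply when she follows the strategy `σ` (a function of the finite list of
Player I's moves so far) against the moves `q 0, q 1, …` of Player I. -/
def reply (σ : List Cond → Cond) (q : ℕ → Cond) (k : ℕ) : Cond :=
  σ ((List.range (k + 1)).map q)

/-- The position at which Player I makes the `k`-th move, the starting position being `p`. -/
def position (σ : List Cond → Cond) (p : Cond) (q : ℕ → Cond) : ℕ → Cond
  | 0 => p
  | k + 1 => reply σ q k

/-- `p` ensures that `j x = m`: Player II has a winning strategy in the game with starting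
position `p` in which the players alternate, Player I moving first; Player I plays a condition
`≤` the current one, Player II a condition `≤^A` the current one; and Player II wins if and only
if the union of the stems played is an element `x` of `ω^ω` with `j x = m`. -/
def Ensures (A : Set ℕ) (p : Cond) (j : Baire → Fin 2) (m : Fin 2) : Prop :=
  ∃ σ : List Cond → Cond, ∀ q : ℕ → Cond,
    (∀ k, (q k).Le (position σ p q k)) →
      (∀ k, (reply σ q k).LeA A (q k)) ∧
      ∃ x : Baire, (∀ k, IsInit (reply σ q k).stem x) ∧
        (∀ n, ∃ k, n ≤ (reply σ q k).stem.length) ∧ j x = m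

end Encoding

namespace Encoding

/-! ### The orders on conditions -/

/-! The first assertion rests on a fusion of games. Player II can play countably many games on one
descending sequence of conditions: game `i` is opened at time `i` and is served at the times
`Nat.pair i k`, and whatever happens between two of its replies counts as a move of Player I there
(`fusion_limit`). All games produce the same real `x`. In `exists_eq_of_ensures` game `i` fixes the
value of `g x i`, and Player I then appends one element of `A` whose colour is that value. As Player
II never adds an element of `A`, reading the colours along `x` gives back `g x`.

The second assertion compares two ways of extending conditions. Conditions deciding a Borel
statement are dense in `ℍ`, but reaching them might require values in `A`. Close a set `S` of
sequences by adding a node once infinitely many of its children are present. Density puts the given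
stem into this closure. If no `A`-avoiding extension reached `S`, then at the first stage at which
an `A`-avoiding extension `s` is added, the children already present, beyond the bound, would be an
infinite subset of `A`, which computes `a`. The stage before `s` is a section of a well-founded
relation on `ω` solving a recursion, so this subset is definable from `S` with real quantifiers
(`sigma21_of_stage`, `exists_avoidExt`). The relevant `S` is read off from the forcing relation, and
that is determined on true codes by local clauses about a single set of reals. Hence failure would
give `a ∈ Σ²₁(c)`.

Finally `Forces.ensuresSet` turns forcing into ensuring by induction on the code: unions use the
reachability argument, intersections use fusion. The last two assertions combine the first two. -/

theorem RightExt.refl (h : List ℕ → ℕ) (t : List ℕ) : RightExt h t t :=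
  ⟨List.prefix_rfl, fun _ hn hle => absurd hn (not_lt.2 hle)⟩

theorem RightExt.trans {h₁ h₂ : List ℕ → ℕ} {t₁ t₂ t₃ : List ℕ} (h₃₂ : RightExt h₂ t₃ t₂)
    (h₂₁ : RightExt h₁ t₂ t₁) (hh : ∀ t, h₁ t ≤ h₂ t) : RightExt h₁ t₃ t₁ := by
  refine ⟨h₂₁.1.trans h₃₂.1, fun n hn hle => ?_⟩
  by_cases hn₂ : n < t₂.length
  · have h1 := h₂₁.2 n hn₂ hle
    obtain ⟨s, rfl⟩ := h₃₂.1
    rwa [List.take_append_of_le_length hn₂.le, List.getElem_append_left hn₂]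
  · exact (hh _).trans (h₃₂.2 n hn (not_lt.1 hn₂))

theorem RightExt.concat {h : List ℕ → ℕ} {t : List ℕ} {n : ℕ} (hn : h t ≤ n) :
    RightExt h (t ++ [n]) t := by
  refine ⟨List.prefix_append _ _, fun k hk hle => ?_⟩
  have : k = t.length := by simp at hk; omega
  subst this
  simpa using hn

theorem AvoidExt.refl (A : Set ℕ) (t : List ℕ) : AvoidExt A t t :=
  ⟨List.prefix_rfl, fun _ hn hle => absurd hn (not_lt.2 hle)⟩

theorem AvoidExt.trans {A : Set ℕ} {t₁ t₂ t₃ : List ℕ} (h₃₂ : AvoidExt A t₃ t₂)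
    (h₂₁ : AvoidExt A t₂ t₁) : AvoidExt A t₃ t₁ := by
  refine ⟨h₂₁.1.trans h₃₂.1, fun n hn hle => ?_⟩
  by_cases hn₂ : n < t₂.length
  · have h1 := h₂₁.2 n hn₂ hle
    obtain ⟨s, rfl⟩ := h₃₂.1
    rwa [List.getElem_append_left hn₂]
  · exact h₃₂.2 n hn (not_lt.1 hn₂)

theorem AvoidExt.concat {A : Set ℕ} {t : List ℕ} {n : ℕ} (hn : n ∉ A) :
    AvoidExt A (t ++ [n]) t := by
  refine ⟨List.prefix_append _ _, fun k hk hle => ?_⟩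
  have : k = t.length := by simp at hk; omega
  subst this
  simpa using hn

theorem Cond.Le.refl (p : Cond) : p.Le p := ⟨RightExt.refl _ _, fun _ => le_rfl⟩

theorem Cond.Le.trans {p q r : Cond} (hrq : r.Le q) (hqp : q.Le p) : r.Le p :=
  ⟨hrq.1.trans hqp.1 hqp.2, fun t => (hqp.2 t).trans (hrq.2 t)⟩

theorem Cond.LeA.le {A : Set ℕ} {p q : Cond} (h : q.LeA A p) : q.Le p := ⟨h.1, h.2.2⟩

theorem Cond.LeA.refl (A : Set ℕ) (p : Cond) : p.LeA A p :=
  ⟨RightExt.refl _ _, AvoidExt.refl _ _, fun _ => le_rfl⟩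

theorem Cond.LeA.trans {A : Set ℕ} {p q r : Cond} (hrq : r.LeA A q) (hqp : q.LeA A p) :
    r.LeA A p :=
  ⟨hrq.1.trans hqp.1 hqp.2.2, hrq.2.1.trans hqp.2.1, fun t => (hqp.2.2 t).trans (hrq.2.2 t)⟩

theorem IsInit.of_prefix {s t : List ℕ} {x : Baire} (hst : s <+: t) (h : IsInit t x) :
    IsInit s x := by
  obtain ⟨u, rfl⟩ := hst
  intro i hi
  rw [← h i (by simp; omega), List.getElem_append_left hi]

theorem IsInit.prefix {s t : List ℕ} {x : Baire} (hs : IsInit s x) (ht : IsInit t x)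
    (hle : s.length ≤ t.length) : s <+: t := by
  rw [List.prefix_iff_eq_take]
  apply List.ext_getElem
  · simp [hle]
  · intro i h₁ h₂
    simp only [List.getElem_take]
    rw [hs i h₁, ht]

/-! ### Games with an arbitrary payoff set -/

/-- `σ` is a winning strategy of Player II in the game with starting position `p` in which she
has to produce an element of `D`. -/
def Wins (A : Set ℕ) (σ : List Cond → Cond) (p : Cond) (D : Set Baire) : Prop :=
  ∀ q : ℕ → Cond, (∀ k, (q k).Le (position σ p q k)) →
    (∀ k, (reply σ q k).LeA A (q k)) ∧
    ∃ x : Baire, (∀ k, IsInit (reply σ q k).stem x) ∧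
      (∀ n, ∃ k, n ≤ (reply σ q k).stem.length) ∧ x ∈ D

/-- Player II can force the result of the game starting at `p` into `D`. -/
def EnsuresSet (A : Set ℕ) (p : Cond) (D : Set Baire) : Prop :=
  ∃ σ, Wins A σ p D

/-- A sequence can be defined by a rule that computes each entry from the preceding ones. -/
theorem exists_seq_of_history {α : Type*} (F : List α → α) :
    ∃ q : ℕ → α, ∀ n, q n = F ((List.range n).map q) := by
  let hist : ℕ → List α := fun n => Nat.rec [] (fun _ l => l ++ [F l]) n
  refine ⟨fun n => F (hist n), fun n => ?_⟩
  have : ∀ n, hist n = (List.range n).map (fun n => F (hist n)) := by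
    intro n
    induction n with
    | zero => rfl
    | succ n ih =>
      rw [List.range_succ, List.map_append, ← ih]
      rfl
  exact congrArg F (this n)

theorem reply_congr {σ : List Cond → Cond} {q q' : ℕ → Cond} {k : ℕ}
    (h : ∀ i ≤ k, q i = q' i) : reply σ q k = reply σ q' k := by
  unfold reply
  congr 1
  apply List.map_congr_left
  intro i hi
  exact h i (by simpa [Nat.lt_succ_iff] using hi)

theorem position_congr {σ : List Cond → Cond} {p : Cond} {q q' : ℕ → Cond} {k : ℕ}
    (h : ∀ i < k, q i = q' i) : position σ p q k = position σ p q' k := by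
  cases k with
  | zero => rfl
  | succ k => exact reply_congr fun i hi => h i (Nat.lt_succ_of_le hi)

theorem Wins.mono {A : Set ℕ} {σ : List Cond → Cond} {p : Cond} {D E : Set Baire}
    (h : Wins A σ p D) (hDE : D ⊆ E) : Wins A σ p E := fun q hq =>
  let ⟨h₁, x, h₂, h₃, h₄⟩ := h q hq
  ⟨h₁, x, h₂, h₃, hDE h₄⟩

theorem EnsuresSet.mono {A : Set ℕ} {p : Cond} {D E : Set Baire}
    (h : EnsuresSet A p D) (hDE : D ⊆ E) : EnsuresSet A p E :=
  h.imp fun _ hσ => hσ.mono hDE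

/-- The replies of a winning strategy are legal along every finite legal play. -/
theorem Wins.reply_leA {A : Set ℕ} {σ : List Cond → Cond} {p : Cond} {D : Set Baire}
    (hW : Wins A σ p D) {q : ℕ → Cond} {k : ℕ}
    (hq : ∀ i ≤ k, (q i).Le (position σ p q i)) : (reply σ q k).LeA A (q k) := by
  -- The finite play is prolonged by letting Player I pass: after time `k` each move repeats the
  -- last reply.
  obtain ⟨q', hq'⟩ := exists_seq_of_history
    (fun l : List Cond => if l.length ≤ k then q l.length else σ l)
  have hlow : ∀ i ≤ k, q' i = q i := fun i hi => by rw [hq' i]; simp [hi]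
  have := (hW q' fun i => ?_).1 k
  · rwa [reply_congr hlow, hlow k le_rfl] at this
  · rcases le_or_gt i k with hi | hi
    · rw [hlow i hi, position_congr fun j hj => hlow j (by omega)]
      exact hq i hi
    · obtain ⟨i, rfl⟩ : ∃ i', i = i' + 1 := ⟨i - 1, by omega⟩
      have : q' (i + 1) = position σ p q' (i + 1) := by
        rw [hq' (i + 1)]
        simp [not_le.2 hi, position, reply]
      rw [this]
      exact Cond.Le.refl _

/-- Countably many games are played on the same sequence of conditions: the `i`-th one starts at
the condition `r i`, and the reply at time `τ` is made in the game `τ.unpair.1`. -/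
theorem fusion_limit {A : Set ℕ} {D : ℕ → Set Baire} {u q r : ℕ → Cond}
    {σ : ℕ → List Cond → Cond} (hq : ∀ τ, (q τ).Le (u τ))
    (hr : ∀ τ, (q τ).Le (u 0) → (r τ).LeA A (q τ) ∧ Wins A (σ τ) (r τ) (D τ))
    (hu : ∀ τ, u (τ + 1) =
      reply (σ τ.unpair.1) (fun b => r (Nat.pair τ.unpair.1 b)) τ.unpair.2) :
    (∀ τ, (r τ).LeA A (q τ)) ∧ (∀ τ, (u (τ + 1)).LeA A (r τ)) ∧
      ∃ x : Baire, (∀ τ, IsInit (u τ).stem x) ∧ (∀ n, ∃ τ, n ≤ (u τ).stem.length) ∧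
        ∀ i, x ∈ D i := by
  have chain : ∀ τ, (∀ s < τ, (u (s + 1)).LeA A (r s)) →
      ∀ s ≤ τ, (u τ).Le (u s) ∧ (q s).Le (u 0) ∧ (r s).Le (u s) := by
    intro τ
    induction τ with
    | zero =>
      intro _ s hs
      obtain rfl : s = 0 := by omega
      exact ⟨Cond.Le.refl _, hq 0, (hr 0 (hq 0)).1.le.trans (hq 0)⟩
    | succ τ ih =>
      intro h s hs
      have ih := ih fun s hs => h s (by omega)
      have hstep : (u (τ + 1)).Le (u τ) :=
        (h τ (by omega)).le.trans (ih τ le_rfl).2.2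
      rcases Nat.lt_or_ge s (τ + 1) with hs' | hs'
      · exact ⟨hstep.trans (ih s (by omega)).1, (ih s (by omega)).2⟩
      · obtain rfl : s = τ + 1 := by omega
        have h0 : (q (τ + 1)).Le (u 0) :=
          (hq _).trans (hstep.trans (ih 0 (by omega)).1)
        exact ⟨Cond.Le.refl _, h0, (hr _ h0).1.le.trans (hq _)⟩
  have legal : ∀ i k, (∀ s < Nat.pair i k, (u (s + 1)).LeA A (r s)) →
      (r (Nat.pair i k)).Le (position (σ i) (r i) (fun b => r (Nat.pair i b)) k) := by
    intro i k h
    have hc := chain _ h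
    cases k with
    | zero =>
      -- Game `i` is opened at time `i` and gets its first move at time `Nat.pair i 0`. The two
      -- times may coincide, and then that move is the starting position itself.
      rcases Nat.eq_or_lt_of_le (Nat.left_le_pair i 0) with he | hlt
      · rw [← he]; exact Cond.Le.refl _
      · exact (hc _ le_rfl).2.2.trans ((hc (i + 1) hlt).1.trans (h i hlt).le)
    | succ k =>
      have hlt : Nat.pair i k < Nat.pair i (k + 1) := Nat.pair_lt_pair_right i (Nat.lt_succ_self k)
      have := hu (Nat.pair i k)
      simp only [Nat.unpair_pair] at this
      change Cond.Le _ (reply _ _ k)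
      rw [← this]
      exact (hc _ le_rfl).2.2.trans (hc _ hlt).1
  have main : ∀ τ, (u (τ + 1)).LeA A (r τ) := by
    intro τ
    induction τ using Nat.strong_induction_on with
    | _ τ ih =>
      have hW := (hr _ (chain τ ih τ.unpair.1 (Nat.unpair_left_le τ)).2.1).2
      have := hW.reply_leA (q := fun b => r (Nat.pair τ.unpair.1 b)) (k := τ.unpair.2) ?_
      · rw [hu τ]; simpa using this
      · intro b hb
        apply legal
        intro s hs
        apply ih
        refine lt_of_lt_of_le hs ?_
        conv_rhs => rw [← Nat.pair_unpair τ]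
        rcases Nat.eq_or_lt_of_le hb with h | h
        · rw [h]
        · exact (Nat.pair_lt_pair_right _ h).le
  have hc := fun τ => chain τ fun s _ => main s
  have hle : ∀ {s τ}, s ≤ τ → (u τ).Le (u s) := fun h => (hc _ _ h).1
  have hres := fun i => ((hr i (hc i i le_rfl).2.1).2 (fun b => r (Nat.pair i b))
    fun k => legal i k fun s _ => main s).2
  have hrep : ∀ i k, reply (σ i) (fun b => r (Nat.pair i b)) k = u (Nat.pair i k + 1) := by
    intro i k
    rw [hu]; simp
  simp only [hrep] at hres
  have init_all : ∀ i x, (∀ k, IsInit (u (Nat.pair i k + 1)).stem x) →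
      ∀ τ, IsInit (u τ).stem x := by
    intro i x hx τ
    refine IsInit.of_prefix (hle ?_).1.1 (hx τ)
    have := Nat.right_le_pair i τ
    omega
  obtain ⟨x, hx, hlen, hx0⟩ := hres 0
  refine ⟨fun τ => (hr τ (hc τ τ le_rfl).2.1).1, main, x, init_all 0 x hx,
    fun n => (hlen n).imp' _ fun _ h => h, fun i => ?_⟩
  obtain ⟨y, hy, -, hyi⟩ := hres i
  -- The stems seen by game `i` are cofinal in the common sequence of positions, so every game has
  -- the same result.
  have : y = x := by
    funext n
    obtain ⟨k, hk⟩ := hlen (n + 1)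
    rw [← init_all i y hy _ n hk, ← hx k n hk]
  exact this ▸ hyi

/-- The reply at time `τ` in the situation of `fusion_limit` to the moves `q` of Player I, where
`r i c` and `σ i c` are the condition and the strategy chosen for the `i`-th game at `c`. -/
def fusionReply (r : ℕ → Cond → Cond) (σ : ℕ → Cond → List Cond → Cond) (q : ℕ → Cond) (τ : ℕ) :
    Cond :=
  reply (σ τ.unpair.1 (q τ.unpair.1))
    (fun b => r (Nat.pair τ.unpair.1 b) (q (Nat.pair τ.unpair.1 b))) τ.unpair.2

theorem fusionReply_congr {r : ℕ → Cond → Cond} {σ : ℕ → Cond → List Cond → Cond}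
    {q q' : ℕ → Cond} {τ : ℕ} (hqq : ∀ i ≤ τ, q i = q' i) :
    fusionReply r σ q τ = fusionReply r σ q' τ := by
  unfold fusionReply
  rw [hqq _ (Nat.unpair_left_le τ)]
  refine reply_congr fun b hb => ?_
  rw [hqq]
  conv_rhs => rw [← Nat.pair_unpair τ]
  rcases Nat.eq_or_lt_of_le hb with h | h
  · rw [h]
  · exact (Nat.pair_lt_pair_right _ h).le

/-- If below every condition each `D i` can be ensured by an `A`-avoiding extension, then all of
them can be ensured simultaneously. -/
theorem EnsuresSet.iInter {A : Set ℕ} {p : Cond} {D : ℕ → Set Baire}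
    (h : ∀ q : Cond, q.Le p → ∀ i, ∃ r : Cond, r.LeA A q ∧ EnsuresSet A r (D i)) :
    EnsuresSet A p (⋂ i, D i) := by
  have : ∀ i (q : Cond), ∃ (r : Cond) (σ : List Cond → Cond), q.Le p →
      r.LeA A q ∧ Wins A σ r (D i) := by
    intro i q
    by_cases hq : q.Le p
    · obtain ⟨r, hr, σ, hσ⟩ := h q hq i
      exact ⟨r, σ, fun _ => ⟨hr, hσ⟩⟩
    · exact ⟨p, fun _ => p, fun h => absurd h hq⟩
  choose r σ hrσ using this
  -- The current time is one less than the number of moves. Only moves up to that time are read, so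
  -- the default `p` plays no role.
  let S : List Cond → Cond := fun l => fusionReply r σ (fun n => l.getD n p) (l.length - 1)
  have hS : ∀ q k, reply S q k = fusionReply r σ q k := by
    intro q k
    simp only [reply, S, List.length_map, List.length_range, Nat.add_sub_cancel]
    apply fusionReply_congr
    intro i hi
    rw [List.getD_eq_getElem _ _ (by simp; omega)]
    simp
  refine ⟨S, fun q hq => ?_⟩
  have hpos : ∀ τ, position S p q (τ + 1) = fusionReply r σ q τ := hS q
  obtain ⟨h₁, h₂, x, h₃, h₄, h₅⟩ := fusion_limit (A := A) (D := D) (u := position S p q) (q := q)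
    (r := fun τ => r τ (q τ)) (σ := fun τ => σ τ (q τ)) hq (fun τ hτ => hrσ τ (q τ) hτ) hpos
  refine ⟨fun k => (h₂ k).trans (h₁ k), x, fun k => h₃ (k + 1), fun n => ?_,
    Set.mem_iInter.2 h₅⟩
  obtain ⟨τ, hτ⟩ := h₄ n
  exact ⟨τ, hτ.trans (((h₂ τ).le.trans ((h₁ τ).le.trans (hq τ))).1.1.length_le)⟩

/-- Player I moves first, so Player II can wait for that move before choosing `r`; formally this is
fusion for a constant family. -/
theorem EnsuresSet.of_dense {A : Set ℕ} {p : Cond} {D : Set Baire}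
    (h : ∀ q : Cond, q.Le p → ∃ r : Cond, r.LeA A q ∧ EnsuresSet A r D) :
    EnsuresSet A p D := by
  simpa [Set.iInter_const] using EnsuresSet.iInter (D := fun _ => D) fun q hq _ => h q hq

/-- If `A` is coinfinite, Player II can make sure that an infinite sequence is produced. -/
theorem ensuresSet_rightExt {A : Set ℕ} (hA : Aᶜ.Infinite) (p : Cond) :
    EnsuresSet A p {x | ∃ u : ℕ → List ℕ, (∀ k, RightExt p.bound (u k) p.stem ∧ IsInit (u k) x) ∧
      ∀ n, ∃ k, n ≤ (u k).length} := by
  have hA' : ∀ n, ∃ m, n ≤ m ∧ m ∉ A := fun n => by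
    obtain ⟨m, hm, hn⟩ := hA.exists_gt n
    exact ⟨m, hn.le, hm⟩
  choose next hnext using hA'
  let ext : Cond → Cond := fun q => ⟨q.stem ++ [next (q.bound q.stem)], q.bound⟩
  have hext : ∀ q, (ext q).LeA A q := fun q =>
    ⟨RightExt.concat (hnext _).1, AvoidExt.concat (hnext _).2, fun _ => le_rfl⟩
  let S : List Cond → Cond := fun l => ext (l.getLastD p)
  have hS : ∀ q k, reply S q k = ext (q k) := by
    intro q k
    simp [reply, S, List.range_succ]
  refine ⟨S, fun q hq => ?_⟩
  have hpos : ∀ k, position S p q (k + 1) = ext (q k) := hS q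
  simp only [hS]
  have hstep : ∀ k, (q (k + 1)).Le (ext (q k)) := fun k => hpos k ▸ hq (k + 1)
  have hmono : ∀ k l, k ≤ l → (q l).Le (q k) := by
    intro k l hkl
    induction hkl with
    | refl => exact Cond.Le.refl _
    | step _ ih => exact ((hstep _).trans (hext _).le).trans ih
  have hlen : ∀ k, k < (ext (q k)).stem.length := by
    intro k
    induction k with
    | zero => simp [ext]
    | succ k ih =>
      have := (hstep k).1.1.length_le
      simp only [ext, List.length_append, List.length_singleton] at *
      omega
  have hpre : ∀ k l, k ≤ l → (ext (q k)).stem <+: (ext (q l)).stem := by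
    intro k l hkl
    rcases Nat.eq_or_lt_of_le hkl with rfl | h
    · exact List.prefix_rfl
    · exact (((hext _).le.trans (hmono (k + 1) l h)).trans (hstep k)).1.1
  let x : Baire := fun n => (ext (q n)).stem[n]'(hlen n)
  have hx : ∀ k, IsInit (ext (q k)).stem x := by
    intro k i hi
    rcases le_total i k with h | h
    · obtain ⟨s, hs⟩ := hpre i k h
      simp only [x, ← hs]
      exact List.getElem_append_left (hlen i)
    · obtain ⟨s, hs⟩ := hpre k i h
      simp only [x, ← hs]
      exact (List.getElem_append_left hi).symm
  refine ⟨fun k => hext _, x, hx, fun n => ⟨n, (hlen n).le⟩, fun k => (ext (q k)).stem,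
    fun k => ⟨?_, hx k⟩, fun n => ⟨n, (hlen n).le⟩⟩
  exact (((hext _).le.trans (hmono 0 k (Nat.zero_le k))).trans (hq 0)).1

/-! ### Meeting `g` along a generic play -/

/-- If `x` takes values in `A` exactly at the places `i 0 < i 1 < ⋯`, then these places are
enumerated by `Nat.nth`. -/
theorem nth_eq_of_strictMono {P : ℕ → Prop} {i : ℕ → ℕ} (hi : StrictMono i)
    (hP : ∀ n, P n ↔ ∃ k, i k = n) (k : ℕ) : Nat.nth P k = i k := by
  induction k using Nat.strong_induction_on with
  | _ k ih =>
    rw [Nat.nth_eq_sInf]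
    apply le_antisymm
    · refine Nat.sInf_le ⟨(hP _).2 ⟨k, rfl⟩, fun l hl => ?_⟩
      rw [ih l hl]
      exact hi hl
    · refine le_csInf ⟨i k, (hP _).2 ⟨k, rfl⟩, fun l hl => by rw [ih l hl]; exact hi hl⟩ ?_
      rintro n ⟨hn, hlt⟩
      obtain ⟨l, rfl⟩ := (hP n).1 hn
      by_contra hlk
      have hlk : l < k := hi.lt_iff_lt.1 (not_le.1 hlk)
      have := hlt l hlk
      rw [ih l hlk] at this
      exact lt_irrefl _ this

/-- Both sides of a fused play are constructed. Player II follows her strategies, and Player I uses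
his moves to write the values already promised for `g x` into `x` as colours of elements of `A`. -/
theorem exists_eq_of_ensures {A : Set ℕ} {η : A → Fin 2} (hη : ∀ m, {n | η n = m}.Infinite)
    {f : Baire → Cantor} (hf : IsEncodingFun A η f) {g : Baire → Cantor}
    (H : ∀ (i : ℕ) (p : Cond), ∃ (m : Fin 2) (p' : Cond),
      p'.LeA A p ∧ Ensures A p' (fun x => g x i) m) :
    ∃ x, f x = g x := by
  have H' : ∀ (i : ℕ) (p : Cond), ∃ (m : Fin 2) (r : Cond) (σ : List Cond → Cond),
      r.LeA A p ∧ Wins A σ r {x | g x i = m} := fun i p =>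
    let ⟨m, r, hr, σ, hσ⟩ := H i p
    ⟨m, r, σ, hr, hσ⟩
  choose m r σ hr hσ using H'
  have hη' : ∀ (m : Fin 2) (b : ℕ), ∃ n : A, b ≤ n ∧ η n = m := by
    intro m b
    have := ((hη m).image (f := ((↑) : A → ℕ)) Subtype.val_injective.injOn).exists_gt b
    obtain ⟨_, ⟨n, hn, rfl⟩, hb⟩ := this
    exact ⟨n, hb.le, hn⟩
  choose el hel hηel using hη'
  let p₀ : Cond := ⟨[], fun _ => 0⟩
  let ext : Cond → Fin 2 → Cond := fun q i => ⟨q.stem ++ [(el i (q.bound q.stem) : ℕ)], q.bound⟩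
  -- The move at time `τ + 1` extends the current position by one element of `A` coloured by the
  -- value that the game opened at time `τ` guarantees. The first move has empty stem, so no
  -- uncontrolled value lies in `A`.
  obtain ⟨q, hq⟩ := exists_seq_of_history (fun l : List Cond =>
    if l.length = 0 then p₀ else
      ext (fusionReply r σ (fun n => l.getD n p₀) (l.length - 1))
        (m (l.length - 1) (l.getD (l.length - 1) p₀)))
  let u : ℕ → Cond := fun τ => Nat.casesOn τ p₀ (fusionReply r σ q)
  have hq0 : q 0 = p₀ := by rw [hq]; simp
  have hqs : ∀ τ, q (τ + 1) = ext (u (τ + 1)) (m τ (q τ)) := by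
    intro τ
    have hget : ∀ i ≤ τ, ((List.range (τ + 1)).map q).getD i p₀ = q i := fun i hi => by
      rw [List.getD_eq_getElem _ _ (by simp; omega)]
      simp
    rw [hq (τ + 1)]
    simp only [List.length_map, List.length_range, Nat.add_eq_zero_iff, one_ne_zero, and_false,
      if_false, Nat.add_sub_cancel]
    rw [hget τ le_rfl, fusionReply_congr hget]
  have hqu : ∀ τ, (q τ).Le (u τ) := by
    intro τ
    cases τ with
    | zero => rw [hq0]; exact Cond.Le.refl _
    | succ τ =>
      rw [hqs]
      exact ⟨RightExt.concat (hel _ _), fun _ => le_rfl⟩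
  obtain ⟨h₁, h₂, x, h₃, h₄, h₅⟩ := fusion_limit (A := A)
    (D := fun τ => {x | g x τ = m τ (q τ)}) (u := u) (q := q)
    (r := fun τ => r τ (q τ)) (σ := fun τ => σ τ (q τ)) hqu
    (fun τ _ => ⟨hr τ (q τ), hσ τ (q τ)⟩) (fun τ => rfl)
  have huq : ∀ τ, (u (τ + 1)).LeA A (q τ) := fun τ => (h₂ τ).trans (h₁ τ)
  let i : ℕ → ℕ := fun k => (u (k + 1)).stem.length
  have hlen : ∀ k, (q (k + 1)).stem.length = i k + 1 := by
    intro k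
    rw [hqs]; simp [ext, i]
  have hi : StrictMono i := strictMono_nat_of_lt_succ fun k => by
    have := (huq (k + 1)).1.1.length_le
    rw [hlen] at this
    exact this
  have hxi : ∀ k, x (i k) = el (m k (q k)) ((u (k + 1)).bound (u (k + 1)).stem) := by
    intro k
    have hinit : IsInit (q (k + 1)).stem x := (h₃ (k + 2)).of_prefix (huq (k + 1)).1.1
    rw [← hinit (i k) (by rw [hlen]; omega)]
    simp [hqs, ext, i]
  have hP : ∀ n, x n ∈ A ↔ ∃ k, i k = n := by
    intro n
    constructor
    · intro hn
      -- Apart from the places `i τ`, all values come from Player II's extensions, which avoid `A`.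
      have key : ∀ τ, n < (u (τ + 1)).stem.length → ∃ k, i k = n := by
        intro τ
        induction τ with
        | zero =>
          intro hlt
          refine absurd hn ?_
          rw [← h₃ 1 n hlt]
          exact (huq 0).2.1.2 n hlt (by rw [hq0]; exact Nat.zero_le _)
        | succ τ ih =>
          intro hlt
          rcases lt_trichotomy n (i τ) with h | h | h
          · exact ih h
          · exact ⟨τ, h.symm⟩
          · refine absurd hn ?_
            rw [← h₃ (τ + 2) n hlt]
            exact (huq (τ + 1)).2.1.2 n hlt (by rw [hlen]; omega)
      obtain ⟨τ, hτ⟩ := h₄ (n + 1)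
      refine key τ (hτ.trans ?_)
      exact ((huq τ).le.trans (hqu τ)).1.1.length_le
    · rintro ⟨k, rfl⟩
      rw [hxi]
      exact Subtype.property _
  have hinf : {n | x n ∈ A}.Infinite := by
    have : {n | x n ∈ A} = Set.range i := by ext n; exact hP n
    rw [this]
    exact Set.infinite_range_of_injective hi.injective
  refine ⟨x, funext fun k => ?_⟩
  obtain ⟨hk, hfk⟩ := hf x hinf k
  rw [hfk, show g x k = m k (q k) from h₅ k,
    ← hηel (m k (q k)) ((u (k + 1)).bound (u (k + 1)).stem)]
  congr 1
  apply Subtype.ext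
  change x (Nat.nth (fun i => x i ∈ A) k) = _
  rw [nth_eq_of_strictMono hi hP, hxi]

/-! ### Definability -/

/-- A context: every element of `Γ` determines the values of all variables. -/
class Ctx (Γ : Type) where
  set : Γ → Set Baire
  num : Γ → ℕ → ℕ
  real : Γ → ℕ → Baire

instance {Γ : Type} [Ctx Γ] : Ctx (Γ × ℕ) where
  set γ := Ctx.set γ.1
  num γ := push γ.2 (Ctx.num γ.1)
  real γ := Ctx.real γ.1

instance {Γ : Type} [Ctx Γ] : Ctx (Γ × Baire) where
  set γ := Ctx.set γ.1
  num γ := Ctx.num γ.1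
  real γ := push γ.2 (Ctx.real γ.1)

/-- `R` is defined by a formula. -/
def Def {Γ : Type} [Ctx Γ] (R : Γ → Prop) : Prop :=
  ∃ φ : Formula, ∀ γ, φ.Sat (Ctx.set γ) (Ctx.num γ) (Ctx.real γ) ↔ R γ

/-- The graph of `f` is defined by a formula. -/
def NDef {Γ : Type} [Ctx Γ] (f : Γ → ℕ) : Prop :=
  Def fun p : Γ × ℕ => f p.1 = p.2

/-- The real `f γ` is defined by a formula, uniformly in `γ`. -/
def RDef {Γ : Type} [Ctx Γ] (f : Γ → Baire) : Prop :=
  NDef fun p : Γ × ℕ => f p.1 p.2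

/-- Renaming of variables in a term. -/
def NumTerm.rename (π ρ : ℕ → ℕ) : NumTerm → NumTerm
  | .var k => .var (π k)
  | .zero => .zero
  | .succ t => .succ (t.rename π ρ)
  | .add s t => .add (s.rename π ρ) (t.rename π ρ)
  | .mul s t => .mul (s.rename π ρ) (t.rename π ρ)
  | .app k t => .app (ρ k) (t.rename π ρ)

/-- The action of a renaming under a quantifier. -/
def liftRen (π : ℕ → ℕ) : ℕ → ℕ
  | 0 => 0
  | k + 1 => π k + 1

/-- Renaming of the free variables of a formula. -/
def Formula.rename (π ρ : ℕ → ℕ) : Formula → Formula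
  | .eq s t => .eq (s.rename π ρ) (t.rename π ρ)
  | .mem k => .mem (ρ k)
  | .neg φ => .neg (φ.rename π ρ)
  | .and φ ψ => .and (φ.rename π ρ) (ψ.rename π ρ)
  | .exNum φ => .exNum (φ.rename (liftRen π) ρ)
  | .exReal φ => .exReal (φ.rename π (liftRen ρ))

theorem push_comp_liftRen {α : Type} (b : α) (v : ℕ → α) (π : ℕ → ℕ) :
    push b (fun k => v (π k)) = fun k => push b v (liftRen π k) := by
  funext k
  cases k <;> rfl

theorem NumTerm.val_rename (π ρ : ℕ → ℕ) (v : ℕ → ℕ) (r : ℕ → Baire) (t : NumTerm) :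
    (t.rename π ρ).val v r = t.val (fun k => v (π k)) (fun k => r (ρ k)) := by
  induction t with
  | var | zero => rfl
  | succ t ih => simp [rename, val, ih]
  | add s t ihs iht => simp [rename, val, ihs, iht]
  | mul s t ihs iht => simp [rename, val, ihs, iht]
  | app k t ih => simp [rename, val, ih]

theorem Formula.sat_rename (X : Set Baire) (φ : Formula) : ∀ (π ρ : ℕ → ℕ) (v : ℕ → ℕ)
    (r : ℕ → Baire), (φ.rename π ρ).Sat X v r ↔ φ.Sat X (fun k => v (π k)) (fun k => r (ρ k)) := by
  induction φ with
  | eq s t => intro π ρ v r; simp [rename, Sat, NumTerm.val_rename]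
  | mem k => intro π ρ v r; rfl
  | neg φ ih => intro π ρ v r; simp [rename, Sat, ih]
  | and φ ψ ih₁ ih₂ => intro π ρ v r; simp [rename, Sat, ih₁, ih₂]
  | exNum φ ih => intro π ρ v r; simp [rename, Sat, ih, push_comp_liftRen]
  | exReal φ ih => intro π ρ v r; simp [rename, Sat, ih, push_comp_liftRen]

section Closure

variable {Γ Δ : Type} [Ctx Γ] [Ctx Δ]

theorem Def.congr {R R' : Γ → Prop} (h : Def R) (hR : ∀ γ, R γ ↔ R' γ) : Def R' :=
  h.imp fun _ hφ γ => (hφ γ).trans (hR γ)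

/-- Pulling back along a map of contexts that only renames variables. -/
theorem Def.rename {R : Γ → Prop} (h : Def R) (m : Δ → Γ) (π ρ : ℕ → ℕ)
    (hs : ∀ δ, Ctx.set (m δ) = Ctx.set δ) (hn : ∀ δ k, Ctx.num (m δ) k = Ctx.num δ (π k))
    (hr : ∀ δ k, Ctx.real (m δ) k = Ctx.real δ (ρ k)) : Def fun δ => R (m δ) := by
  obtain ⟨φ, hφ⟩ := h
  refine ⟨φ.rename π ρ, fun δ => ?_⟩
  beta_reduce
  rw [Formula.sat_rename, ← hφ, hs, ← funext (hn δ), ← funext (hr δ)]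

theorem Def.not {R : Γ → Prop} (h : Def R) : Def fun γ => ¬ R γ := by
  obtain ⟨φ, hφ⟩ := h
  exact ⟨.neg φ, fun γ => not_congr (hφ γ)⟩

theorem Def.and {R R' : Γ → Prop} (h : Def R) (h' : Def R') : Def fun γ => R γ ∧ R' γ := by
  obtain ⟨φ, hφ⟩ := h
  obtain ⟨ψ, hψ⟩ := h'
  exact ⟨.and φ ψ, fun γ => and_congr (hφ γ) (hψ γ)⟩

theorem Def.or {R R' : Γ → Prop} (h : Def R) (h' : Def R') : Def fun γ => R γ ∨ R' γ :=
  (h.not.and h'.not).not.congr fun γ => by tauto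

theorem Def.imp {R R' : Γ → Prop} (h : Def R) (h' : Def R') : Def fun γ => R γ → R' γ :=
  (h.not.or h').congr fun γ => by tauto

theorem Def.iff {R R' : Γ → Prop} (h : Def R) (h' : Def R') : Def fun γ => (R γ ↔ R' γ) :=
  ((h.imp h').and (h'.imp h)).congr fun γ => by tauto

theorem Def.exN {R : Γ → ℕ → Prop} (h : Def fun p : Γ × ℕ => R p.1 p.2) :
    Def fun γ => ∃ n, R γ n := by
  obtain ⟨φ, hφ⟩ := h
  exact ⟨.exNum φ, fun γ => exists_congr fun n => hφ (γ, n)⟩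

theorem Def.exR {R : Γ → Baire → Prop} (h : Def fun p : Γ × Baire => R p.1 p.2) :
    Def fun γ => ∃ x, R γ x := by
  obtain ⟨φ, hφ⟩ := h
  exact ⟨.exReal φ, fun γ => exists_congr fun x => hφ (γ, x)⟩

theorem Def.allN {R : Γ → ℕ → Prop} (h : Def fun p : Γ × ℕ => R p.1 p.2) :
    Def fun γ => ∀ n, R γ n :=
  (Def.exN (R := fun γ n => ¬ R γ n) h.not).not.congr fun γ => by simp

theorem Def.allR {R : Γ → Baire → Prop} (h : Def fun p : Γ × Baire => R p.1 p.2) :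
    Def fun γ => ∀ x, R γ x :=
  (Def.exR (R := fun γ x => ¬ R γ x) h.not).not.congr fun γ => by simp

theorem Def.wkN {R : Γ → Prop} (h : Def R) : Def fun p : Γ × ℕ => R p.1 :=
  h.rename Prod.fst Nat.succ id (fun _ => rfl) (fun _ _ => rfl) (fun _ _ => rfl)

theorem NDef.wkN {f : Γ → ℕ} (h : NDef f) : NDef fun p : Γ × ℕ => f p.1 :=
  Def.rename (Δ := (Γ × ℕ) × ℕ) h (fun p => (p.1.1, p.2)) (fun k => if k = 0 then 0 else k + 1) id
    (fun _ => rfl) (fun _ k => by cases k <;> rfl) (fun _ _ => rfl)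

theorem NDef.wkR {f : Γ → ℕ} (h : NDef f) : NDef fun p : Γ × Baire => f p.1 :=
  Def.rename (Δ := (Γ × Baire) × ℕ) h (fun p => (p.1.1, p.2)) id Nat.succ
    (fun _ => rfl) (fun _ _ => rfl) (fun _ _ => rfl)

theorem RDef.wkN {f : Γ → Baire} (h : RDef f) : RDef fun p : Γ × ℕ => f p.1 :=
  Def.rename (Δ := ((Γ × ℕ) × ℕ) × ℕ) h (fun p => ((p.1.1.1, p.1.2), p.2))
    -- The two innermost variables are the argument and the value of the real; the new variable is
    -- inserted behind them.
    (fun k => if k ≤ 1 then k else k + 1) id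
    (fun _ => rfl) (fun _ k => by rcases k with _ | _ | k <;> rfl) (fun _ _ => rfl)

theorem RDef.wkR {f : Γ → Baire} (h : RDef f) : RDef fun p : Γ × Baire => f p.1 :=
  Def.rename (Δ := ((Γ × Baire) × ℕ) × ℕ) h (fun p => ((p.1.1.1, p.1.2), p.2)) id Nat.succ
    (fun _ => rfl) (fun _ _ => rfl) (fun _ _ => rfl)

theorem NDef.of_term {f : Γ → ℕ} (t : NumTerm)
    (ht : ∀ γ, t.val (Ctx.num γ) (Ctx.real γ) = f γ) : NDef f := by
  refine ⟨.eq (t.rename Nat.succ id) (.var 0), fun γ => ?_⟩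
  simp only [Formula.Sat, NumTerm.val_rename, ← ht]
  rfl

/-- A definable function need not be given by a term, so it is substituted by quantifying over its
value. -/
theorem Def.compN {R : Γ → ℕ → Prop} {f : Γ → ℕ} (h : Def fun p : Γ × ℕ => R p.1 p.2)
    (hf : NDef f) : Def fun γ => R γ (f γ) :=
  (Def.exN (R := fun γ n => f γ = n ∧ R γ n) (Def.and hf h)).congr fun γ => by simp

theorem NDef.var0 : NDef fun p : Γ × ℕ => p.2 := NDef.of_term (.var 0) fun _ => rfl

theorem NDef.const (n : ℕ) : NDef fun _ : Γ => n := by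
  have : ∃ t : NumTerm, ∀ v r, t.val v r = n := by
    induction n with
    | zero => exact ⟨.zero, fun _ _ => rfl⟩
    | succ n ih =>
      obtain ⟨t, ht⟩ := ih
      exact ⟨.succ t, fun v r => by simp [NumTerm.val, ht]⟩
  obtain ⟨t, ht⟩ := this
  exact NDef.of_term t fun γ => ht _ _

/-- Substitution of a definable number in a definable function. -/
theorem NDef.compN {F : Γ → ℕ → ℕ} {f : Γ → ℕ} (hF : NDef fun p : Γ × ℕ => F p.1 p.2)
    (hf : NDef f) : NDef fun γ => F γ (f γ) := by
  refine Def.compN (R := fun (p : Γ × ℕ) n => F p.1 n = p.2) ?_ hf.wkN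
  exact Def.rename (Δ := (Γ × ℕ) × ℕ) hF (fun p => ((p.1.1, p.2), p.1.2))
    (fun k => if k = 0 then 1 else if k = 1 then 0 else k) id
    (fun _ => rfl) (fun _ k => by rcases k with _ | _ | k <;> rfl) (fun _ _ => rfl)

theorem NDef.app {x : Γ → Baire} {f : Γ → ℕ} (hx : RDef x) (hf : NDef f) :
    NDef fun γ => x γ (f γ) := NDef.compN (F := x) hx hf

theorem Def.eq {f g : Γ → ℕ} (hf : NDef f) (hg : NDef g) : Def fun γ => f γ = g γ :=
  Def.compN (R := fun γ n => f γ = n) hf hg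

theorem NDef.comp_term {f g : Γ → ℕ} {F : ℕ → ℕ → ℕ} (t : NumTerm)
    (ht : ∀ v r, t.val v r = F (v 1) (v 0)) (hf : NDef f) (hg : NDef g) :
    NDef fun γ => F (f γ) (g γ) := by
  refine NDef.compN (F := fun γ n => F (f γ) n) ?_ hg
  refine NDef.compN (F := fun (p : Γ × ℕ) n => F n p.2) ?_ hf.wkN
  refine NDef.of_term (t.rename (fun k => 1 - k) id) fun γ => ?_
  rw [NumTerm.val_rename, ht]
  rfl

theorem NDef.add {f g : Γ → ℕ} (hf : NDef f) (hg : NDef g) : NDef fun γ => f γ + g γ :=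
  NDef.comp_term (.add (.var 1) (.var 0)) (fun _ _ => rfl) hf hg

theorem NDef.mul {f g : Γ → ℕ} (hf : NDef f) (hg : NDef g) : NDef fun γ => f γ * g γ :=
  NDef.comp_term (.mul (.var 1) (.var 0)) (fun _ _ => rfl) hf hg

theorem Def.le {f g : Γ → ℕ} (hf : NDef f) (hg : NDef g) : Def fun γ => f γ ≤ g γ :=
  (Def.exN (R := fun γ n => g γ = f γ + n) (Def.eq hg.wkN (hf.wkN.add NDef.var0))).congr
    fun _ => le_iff_exists_add.symm

theorem Def.lt {f g : Γ → ℕ} (hf : NDef f) (hg : NDef g) : Def fun γ => f γ < g γ :=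
  Def.le (hf.add (NDef.const 1)) hg

theorem NDef.ite {P : Γ → Prop} [DecidablePred P] {f g : Γ → ℕ} (hP : Def P) (hf : NDef f)
    (hg : NDef g) : NDef fun γ => if P γ then f γ else g γ :=
  ((Def.and hP.wkN hf).or (Def.and hP.wkN.not hg)).congr fun p => by
    by_cases h : P p.1 <;> simp [h]

theorem NDef.pair {f g : Γ → ℕ} (hf : NDef f) (hg : NDef g) :
    NDef fun γ => Nat.pair (f γ) (g γ) :=
  NDef.ite (Def.lt hf hg) ((hg.mul hg).add hf) (((hf.mul hf).add hf).add hg)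

theorem NDef.unpair_fst {f : Γ → ℕ} (hf : NDef f) : NDef fun γ => (f γ).unpair.1 := by
  refine (Def.exN (R := fun (p : Γ × ℕ) n => f p.1 = Nat.pair p.2 n)
    (Def.eq hf.wkN.wkN (NDef.pair NDef.var0.wkN NDef.var0))).congr fun p => ?_
  constructor
  · rintro ⟨n, hn⟩
    beta_reduce
    rw [hn, Nat.unpair_pair]
  · intro h
    exact ⟨(f p.1).unpair.2, by rw [← h, Nat.pair_unpair]⟩

theorem NDef.unpair_snd {f : Γ → ℕ} (hf : NDef f) : NDef fun γ => (f γ).unpair.2 := by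
  refine (Def.exN (R := fun (p : Γ × ℕ) n => f p.1 = Nat.pair n p.2)
    (Def.eq hf.wkN.wkN (NDef.pair NDef.var0 NDef.var0.wkN))).congr fun p => ?_
  constructor
  · rintro ⟨n, hn⟩
    beta_reduce
    rw [hn, Nat.unpair_pair]
  · intro h
    exact ⟨(f p.1).unpair.1, by rw [← h, Nat.pair_unpair]⟩

theorem RDef.var0 : RDef fun p : Γ × Baire => p.2 :=
  NDef.of_term (.app 0 (.var 0)) fun _ => rfl

theorem Def.compR {R : Γ → Baire → Prop} {f : Γ → Baire} (h : Def fun p : Γ × Baire => R p.1 p.2)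
    (hf : RDef f) : Def fun γ => R γ (f γ) := by
  refine (Def.exR (R := fun γ x => (∀ n, f γ n = x n) ∧ R γ x) (Def.and (Def.allN ?_) h)).congr
    fun γ => ?_
  · exact Def.eq (NDef.app hf.wkR.wkN NDef.var0) (NDef.app RDef.var0.wkN NDef.var0)
  · constructor
    · rintro ⟨x, h₁, h₂⟩
      rwa [funext h₁]
    · exact fun h => ⟨_, fun _ => rfl, h⟩

theorem Def.mem {f : Γ → Baire} (hf : RDef f) : Def fun γ => f γ ∈ Ctx.set γ :=
  Def.compR (R := fun γ x => x ∈ Ctx.set γ) ⟨.mem 0, fun _ => Iff.rfl⟩ hf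

end Closure

/-! ### Computable functions are definable -/

/-- The relation `R` is definable, uniformly in all contexts. -/
def PDef (R : Baire → ℕ → ℕ → Prop) : Prop :=
  ∀ {Γ : Type} [Ctx Γ] {o : Γ → Baire} {n m : Γ → ℕ}, RDef o → NDef n → NDef m →
    Def fun γ => R (o γ) (n γ) (m γ)

/-- The graph of a partial function that is recursive in the oracle `O` is definable from `O`. -/
theorem exists_pdef_of_recursiveIn {O : Baire} {f : ℕ →. ℕ}
    (h : Nat.RecursiveIn {(O : ℕ →. ℕ)} f) :
    ∃ R : Baire → ℕ → ℕ → Prop, PDef R ∧ ∀ n m, R O n m ↔ m ∈ f n := by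
  induction h with
  | zero => exact ⟨fun _ _ m => m = 0, fun _ _ hm => Def.eq hm (NDef.const 0), fun n m => by
      change m = 0 ↔ m ∈ Part.some 0; simp⟩
  | succ => exact ⟨fun _ n m => m = n + 1, fun _ hn hm => Def.eq hm (hn.add (NDef.const 1)),
      fun n m => by simp⟩
  | left => exact ⟨fun _ n m => m = n.unpair.1, fun _ hn hm => Def.eq hm hn.unpair_fst,
      fun n m => by simp⟩
  | right => exact ⟨fun _ n m => m = n.unpair.2, fun _ hn hm => Def.eq hm hn.unpair_snd,
      fun n m => by simp⟩
  | oracle g hg =>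
    obtain rfl : g = (O : ℕ →. ℕ) := hg
    exact ⟨fun o n m => m = o n, fun ho hn hm => Def.eq hm (NDef.app ho hn), fun n m => by simp⟩
  | pair _ _ ihf ihh =>
    obtain ⟨R, hR, hRf⟩ := ihf
    obtain ⟨R', hR', hRh⟩ := ihh
    refine ⟨fun o n m => ∃ i j, R o n i ∧ R' o n j ∧ m = Nat.pair i j, fun ho hn hm => ?_, ?_⟩
    · exact Def.exN (Def.exN (Def.and (hR ho.wkN.wkN hn.wkN.wkN NDef.var0.wkN)
        (Def.and (hR' ho.wkN.wkN hn.wkN.wkN NDef.var0)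
          (Def.eq hm.wkN.wkN (NDef.pair NDef.var0.wkN NDef.var0)))))
    · intro n m
      simp only [hRf, hRh, Seq.seq, Part.mem_bind_iff, Part.map_eq_map, Part.mem_map_iff]
      aesop
  | comp _ _ ihf ihh =>
    obtain ⟨R, hR, hRf⟩ := ihf
    obtain ⟨R', hR', hRh⟩ := ihh
    refine ⟨fun o n m => ∃ i, R' o n i ∧ R o i m, fun ho hn hm => ?_, ?_⟩
    · exact Def.exN (Def.and (hR' ho.wkN hn.wkN NDef.var0) (hR ho.wkN NDef.var0 hm.wkN))
    · intro n m
      exact (exists_congr fun i => and_congr (hRh n i) (hRf i m)).trans Part.mem_bind_iff.symm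
  | @prec f h _ _ ihf ihh =>
    obtain ⟨R, hR, hRf⟩ := ihf
    obtain ⟨R', hR', hRh⟩ := ihh
    -- A real quantifier supplies the whole history of the recursion, so no coding of finite
    -- sequences by numbers is needed.
    refine ⟨fun o n m => ∃ y : Baire, R o n.unpair.1 (y 0) ∧ (∀ k, k < n.unpair.2 →
      R' o (Nat.pair n.unpair.1 (Nat.pair k (y k))) (y (k + 1))) ∧ m = y n.unpair.2,
      fun {Γ _ o n m} ho hn hm => ?_, ?_⟩
    · have hy : RDef fun p : (Γ × Baire) × ℕ => p.1.2 := RDef.var0.wkN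
      refine Def.exR (Def.and (hR ho.wkR hn.wkR.unpair_fst (NDef.app RDef.var0 (NDef.const 0)))
        (Def.and (Def.allN (Def.imp (Def.lt NDef.var0 hn.wkR.wkN.unpair_snd) ?_))
          (Def.eq hm.wkR (NDef.app RDef.var0 hn.wkR.unpair_snd))))
      exact hR' ho.wkR.wkN (NDef.pair hn.wkR.wkN.unpair_fst
        (NDef.pair NDef.var0 (NDef.app hy NDef.var0)))
        (NDef.app hy (NDef.var0.add (NDef.const 1)))
    · intro n m
      obtain ⟨a, b, rfl⟩ : ∃ a b, n = Nat.pair a b := ⟨_, _, (Nat.pair_unpair n).symm⟩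
      simp only [Nat.unpair_pair, hRf, hRh]
      induction b generalizing m with
      | zero =>
        constructor
        · rintro ⟨y, h₁, -, rfl⟩
          exact h₁
        · exact fun h => ⟨fun _ => m, h, fun k hk => absurd hk (Nat.not_lt_zero _), rfl⟩
      | succ b ih =>
        simp only [Part.bind_eq_bind, Part.mem_bind_iff]
        constructor
        · rintro ⟨y, h₁, h₂, rfl⟩
          exact ⟨y b, (ih _).1 ⟨y, h₁, fun k hk => h₂ k (by omega), rfl⟩, h₂ b (by omega)⟩
        · rintro ⟨i, hi, hm⟩
          obtain ⟨y, h₁, h₂, rfl⟩ := (ih _).2 hi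
          refine ⟨fun k => if k ≤ b then y k else m, by simpa using h₁, fun k hk => ?_, by simp⟩
          rcases Nat.lt_or_ge k b with h | h
          · simpa [h.le, Nat.succ_le_of_lt h] using h₂ k h
          · obtain rfl : k = b := by omega
            simpa using hm
  | rfind _ ih =>
    obtain ⟨R, hR, hRf⟩ := ih
    refine ⟨fun o n m => R o (Nat.pair n m) 0 ∧ ∀ k, k < m → ∃ i, i ≠ 0 ∧ R o (Nat.pair n k) i,
      fun ho hn hm => ?_, ?_⟩
    · exact Def.and (hR ho (NDef.pair hn hm) (NDef.const 0))
        (Def.allN (Def.imp (Def.lt NDef.var0 hm.wkN) (Def.exN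
          (Def.and (Def.eq NDef.var0 (NDef.const 0)).not
            (hR ho.wkN.wkN (NDef.pair hn.wkN.wkN NDef.var0.wkN) NDef.var0)))))
    · intro n m
      refine Iff.trans ?_ Nat.mem_rfind.symm
      simp only [hRf, Part.map_eq_map, Part.mem_map_iff]
      simp [and_comm]

theorem exists_pdef_of_turingReducible {O d : Baire} (h : (d : ℕ →. ℕ) ≤ᵀ (O : ℕ →. ℕ)) :
    ∃ R : Baire → ℕ → ℕ → Prop, PDef R ∧ ∀ n m, R O n m ↔ d n = m := by
  obtain ⟨R, hR, h⟩ := exists_pdef_of_recursiveIn (RecursiveIn.iff_nat.1 h)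
  exact ⟨R, hR, fun n m => (h n m).trans (by simp [eq_comm])⟩

theorem NDef.comp_primrec {Γ : Type} [Ctx Γ] {F : ℕ → ℕ} (hF : Primrec F) {f : Γ → ℕ}
    (hf : NDef f) : NDef fun γ => F (f γ) := by
  obtain ⟨R, hR, h⟩ := exists_pdef_of_recursiveIn (O := 0)
    (Nat.Primrec.recursiveIn (Primrec.nat_iff.1 hF))
  have h0 : RDef fun _ : Γ × ℕ => (0 : Baire) := NDef.const 0
  exact (hR h0 hf.wkN NDef.var0).congr fun p => (h _ _).trans (by simp [eq_comm])

theorem NDef.comp_primrec₂ {Γ : Type} [Ctx Γ] {F : ℕ → ℕ → ℕ} (hF : Primrec₂ F) {f g : Γ → ℕ}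
    (hf : NDef f) (hg : NDef g) : NDef fun γ => F (f γ) (g γ) := by
  have : Primrec fun n : ℕ => F n.unpair.1 n.unpair.2 :=
    hF.comp (Primrec.fst.comp Primrec.unpair) (Primrec.snd.comp Primrec.unpair)
  simpa using NDef.comp_primrec this (hf.pair hg)

/-! ### Stages of an inductive definition -/

section Stages

variable {N : Type} (child : N → ℕ → N) (S : Set N)

/-- The nodes that are in `S` or have infinitely many children in `D`. -/
def derive (D : Set N) : Set N := S ∪ {s | {n | child s n ∈ D}.Infinite}

/-- The stages in the generation of the least set `D` with `derive child S D ⊆ D`. -/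
inductive IsStage : Set N → Prop
  | mk (F : Set (Set N)) (hF : ∀ D ∈ F, IsStage D) : IsStage (⋃ D ∈ F, derive child S D)

/-- Some stage contains `v` and does not contain `u`. -/
def Earlier (v u : N) : Prop := ∃ D, IsStage child S D ∧ v ∈ D ∧ u ∉ D

variable {child S}

theorem derive_mono {D E : Set N} (h : D ⊆ E) : derive child S D ⊆ derive child S E :=
  Set.union_subset_union_right _ fun _ hs => hs.mono fun _ hn => h hn

theorem IsStage.derive {D : Set N} (hD : IsStage child S D) :
    IsStage child S (derive child S D) := by
  simpa using IsStage.mk {D} (by simpa using hD)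

theorem IsStage.sUnion {F : Set (Set N)} (hF : ∀ D ∈ F, IsStage child S D) :
    IsStage child S (⋃₀ F) := by
  -- All stages whose derivation lies inside a member of `F` are taken as generators, which avoids
  -- choosing generators for each member.
  have : ⋃₀ F = ⋃ D ∈ {D | IsStage child S D ∧ ∃ E ∈ F, Encoding.derive child S D ⊆ E},
      Encoding.derive child S D := by
    apply Set.Subset.antisymm
    · rintro v ⟨E, hE, hv⟩
      rcases hF E hE with ⟨G, hG⟩
      obtain ⟨D, hD, hv⟩ := Set.mem_iUnion₂.1 hv
      exact Set.mem_iUnion₂.2 ⟨D, ⟨hG D hD, _, hE, Set.subset_biUnion_of_mem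
        (u := fun D => Encoding.derive child S D) hD⟩, hv⟩
    · intro v hv
      obtain ⟨D, ⟨-, E, hE, hDE⟩, hv⟩ := Set.mem_iUnion₂.1 hv
      exact ⟨E, hE, hDE hv⟩
  rw [this]
  exact IsStage.mk _ fun D hD => hD.1

/-- A comparison in Zermelo's style, without ordinals. If a generator of `D` has a derivation not
inside `E`, it contains the derivation of each generator of `E`, hence `E`; one further derivation
then stays inside `D`. -/
theorem IsStage.subset_or {D : Set N} (hD : IsStage child S D) : ∀ {E : Set N},
    IsStage child S E → D ⊆ E ∨ Encoding.derive child S E ⊆ D := by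
  induction hD with
  | mk F hF ih =>
    intro E hE
    rcases hE with ⟨G, hG⟩
    by_cases h : ∀ D ∈ F, Encoding.derive child S D ⊆ ⋃ E ∈ G, Encoding.derive child S E
    · exact Or.inl (Set.iUnion₂_subset h)
    · push Not at h
      obtain ⟨D, hD, hDE⟩ := h
      right
      refine Set.Subset.trans (derive_mono (Set.iUnion₂_subset fun E hE => ?_))
        (Set.subset_biUnion_of_mem (u := fun D => Encoding.derive child S D) hD)
      refine (ih D hD (hG E hE)).resolve_left fun h => hDE ?_
      exact (derive_mono h).trans
        (Set.subset_biUnion_of_mem (u := fun D => Encoding.derive child S D) hE)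

/-- At most one stage is followed by the first stage containing `s`. -/
theorem IsStage.unique {D E : Set N} (hD : IsStage child S D) (hE : IsStage child S E) {s : N}
    (hsD : s ∉ D) (hsDer : s ∈ Encoding.derive child S D)
    (hsE : s ∉ E) (hsE' : s ∈ Encoding.derive child S E) : D = E :=
  Set.Subset.antisymm ((hD.subset_or hE).resolve_right fun h => hsD (h hsE'))
    ((hE.subset_or hD).resolve_right fun h => hsE (h hsDer))

theorem IsStage.acc {D : Set N} (hD : IsStage child S D) :
    ∀ u ∈ D, Acc (Earlier child S) u := by
  induction hD with
  | mk F hF ih =>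
    intro u hu
    obtain ⟨D, hD, hu⟩ := Set.mem_iUnion₂.1 hu
    refine Acc.intro _ fun v => ?_
    rintro ⟨E, hE, hv, huE⟩
    exact ih D hD v ((hE.subset_or (hF D hD)).resolve_right (fun h => huE (h hu)) hv)

theorem wellFounded_earlier : WellFounded (Earlier child S) :=
  ⟨fun _ => Acc.intro _ fun v ⟨_, hE, hv, _⟩ => hE.acc v hv⟩

theorem IsStage.mem_derive_earlier {D : Set N} (hD : IsStage child S D) :
    ∀ v ∈ D, v ∈ Encoding.derive child S {x | Earlier child S x v} := by
  induction hD with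
  | mk F hF ih =>
    intro v hv
    obtain ⟨D, hD, hv⟩ := Set.mem_iUnion₂.1 hv
    by_cases hvD : v ∈ D
    · exact ih D hD v hvD
    · have hsub : D ⊆ {x | Earlier child S x v} := fun x hx => ⟨D, hF D hD, hx, hvD⟩
      exact derive_mono hsub hv

/-- This recursion does not mention stages. It lets a binary relation on the nodes, hence a single
real when nodes are numbers, replace the transfinite generation. -/
theorem earlier_iff {v u : N} : Earlier child S v u ↔ ∃ u', Earlier child S u' u ∧
    v ∈ Encoding.derive child S {x | Earlier child S x u'} := by
  constructor
  · rintro ⟨D, hD, hv, hu⟩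
    exact ⟨v, ⟨D, hD, hv, hu⟩, hD.mem_derive_earlier v hv⟩
  · rintro ⟨u', ⟨E, hE, hu', hu⟩, hv⟩
    refine ⟨E, hE, ?_, hu⟩
    rcases hE with ⟨G, hG⟩
    obtain ⟨D, hD, huD⟩ := Set.mem_iUnion₂.1 hu'
    refine Set.mem_iUnion₂.2 ⟨D, hD, derive_mono ?_ hv⟩
    rintro x ⟨E', hE', hx, hE'u⟩
    exact (hE'.subset_or (hG D hD)).resolve_right (fun h => hE'u (h huD)) hx

/-- A well-founded relation satisfying the recursion of `earlier_iff` has stages as sections. -/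
theorem isStage_of_wellFounded {w : N → N → Prop} (hw : WellFounded w)
    (h : ∀ v u, w v u ↔ ∃ u', w u' u ∧ v ∈ derive child S {x | w x u'}) (u : N) :
    IsStage child S {v | w v u} := by
  induction u using hw.induction with
  | _ u ih =>
    have : {v | w v u} = ⋃ D ∈ (fun u' => {x | w x u'}) '' {u' | w u' u}, derive child S D := by
      ext v
      simp [h v u]
    rw [this]
    refine IsStage.mk _ ?_
    rintro _ ⟨v, hv, rfl⟩
    exact ih v hv

/-- A node outside all stages can be kept outside by choosing children beyond a bound. -/
theorem exists_bound_of_notMem :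
    ∃ h : N → ℕ, ∀ s, (∀ D, IsStage child S D → s ∉ D) →
      s ∉ S ∧ ∀ n, h s ≤ n → ∀ D, IsStage child S D → child s n ∉ D := by
  have hU : IsStage child S (⋃₀ {D | IsStage child S D}) := IsStage.sUnion fun D hD => hD
  have : ∀ s, ∃ k, (∀ D, IsStage child S D → s ∉ D) →
      s ∉ S ∧ ∀ n, k ≤ n → ∀ D, IsStage child S D → child s n ∉ D := by
    intro s
    by_cases hs : ∀ D, IsStage child S D → s ∉ D
    · have hnot := hs _ hU.derive
      simp only [Encoding.derive, Set.mem_union, not_or, Set.mem_ofPred_eq,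
        Set.not_infinite] at hnot
      obtain ⟨k, hk⟩ := hnot.2.bddAbove
      refine ⟨k + 1, fun _ => ⟨hnot.1, fun n hn D hD hmem => ?_⟩⟩
      have := hk (show n ∈ {n | child s n ∈ ⋃₀ {D | IsStage child S D}} from ⟨D, hD, hmem⟩)
      omega
    · exact ⟨0, fun h => absurd h hs⟩
  choose h hh using this
  exact ⟨h, hh⟩

end Stages

/-! ### Sets that are defined by a determinate third-order object -/

/-- The context whose only free variables are a set `X` and the fixed real `c`. -/
def CtxOf (_c : Baire) : Type := Set Baire

instance (c : Baire) : Ctx (CtxOf c) where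
  set X := X
  num _ := 0
  real _ := push c 0

/-- `S` can be read off, by a formula, from every `X` satisfying a satisfiable formula. -/
def Delta21 (c : Baire) (S : Set ℕ) : Prop :=
  ∃ (K : CtxOf c → Prop) (Q : CtxOf c → ℕ → Prop), Def K ∧ (Def fun p : CtxOf c × ℕ => Q p.1 p.2) ∧
    (∃ X, K X) ∧ ∀ X, K X → ∀ n, Q X n ↔ n ∈ S

theorem charFun_eq_one {A : Set ℕ} {n : ℕ} : charFun A n = 1 ↔ n ∈ A := by
  simp [charFun]

/-- Every `X` satisfying `K` yields the same set, so guessing such an `X` and then its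
characteristic function `y` cannot produce a wrong value of `a`. -/
theorem sigma21_of_delta21 {c a : Baire} {S : Set ℕ} (hS : Delta21 c S)
    {T : Baire → ℕ → ℕ → Prop} (hT : PDef T) (h : ∀ n m, T (charFun S) n m ↔ a n = m) :
    Sigma21 c a := by
  obtain ⟨K, Q, hK, hQ, ⟨X₀, hX₀⟩, hKQ⟩ := hS
  -- The context lists `m` before `n`, so that `n` becomes variable `0` and `m` variable `1`.
  have hdef : Def fun p : (CtxOf c × ℕ) × ℕ => K p.1.1 ∧ ∃ y : Baire,
      (∀ n, (y n = 1 ∧ Q p.1.1 n) ∨ (y n = 0 ∧ ¬ Q p.1.1 n)) ∧ T y p.2 p.1.2 := by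
    have hQ' : Def fun p : (((CtxOf c × ℕ) × ℕ) × Baire) × ℕ => Q p.1.1.1.1 p.2 :=
      Def.rename (Δ := (((CtxOf c × ℕ) × ℕ) × Baire) × ℕ) hQ (fun p => (p.1.1.1.1, p.2))
        (fun k => if k = 0 then 0 else k + 2) Nat.succ
        (fun _ => rfl) (fun _ k => by cases k <;> rfl) (fun _ _ => rfl)
    have hy : NDef fun p : (((CtxOf c × ℕ) × ℕ) × Baire) × ℕ => p.1.2 p.2 :=
      NDef.app RDef.var0.wkN NDef.var0
    exact Def.and hK.wkN.wkN (Def.exR (Def.and (Def.allN (Def.or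
      (Def.and (Def.eq hy (NDef.const 1)) hQ') (Def.and (Def.eq hy (NDef.const 0)) hQ'.not)))
      (hT RDef.var0 NDef.var0.wkR NDef.var0.wkN.wkR)))
  obtain ⟨φ, hφ⟩ := hdef
  refine ⟨φ, fun n m => ?_⟩
  have key : ∀ X : CtxOf c, φ.Sat X (push n (push m 0)) (push c 0) ↔ K X ∧ ∃ y : Baire,
      (∀ n, (y n = 1 ∧ Q X n) ∨ (y n = 0 ∧ ¬ Q X n)) ∧ T y n m := fun X => hφ ((X, m), n)
  constructor
  · intro ha
    refine ⟨X₀, (key X₀).2 ⟨hX₀, charFun S, fun n => ?_, (h n m).2 ha⟩⟩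
    rw [hKQ X₀ hX₀ n]
    by_cases hn : n ∈ S <;> simp [charFun, hn]
  · rintro ⟨X, hX⟩
    obtain ⟨hKX, y, hy, hTy⟩ := (key X).1 hX
    have : y = charFun S := by
      funext n
      have := hy n
      rw [hKQ X hKX n] at this
      by_cases hn : n ∈ S <;> simpa [charFun, hn] using this
    exact (h n m).1 (this ▸ hTy)

/-! ### Codes of finite sequences -/

open Denumerable (ofNat)

/-- The code of the sequence coded by `s`, followed by `n`. -/
def snoc (s n : ℕ) : ℕ := Encodable.encode (ofNat (List ℕ) s ++ [n])

theorem primrec_ofNat_list : Primrec (ofNat (List ℕ)) := by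
  have : Primrec fun n : ℕ => (Encodable.decode (α := List ℕ) n).getD [] :=
    Primrec.option_getD.comp Primrec.decode (Primrec.const [])
  refine this.of_eq fun n => ?_
  rw [Denumerable.decode_eq_ofNat]
  rfl

theorem primrec₂_snoc : Primrec₂ snoc :=
  Primrec.encode.comp (Primrec.list_concat.comp (primrec_ofNat_list.comp Primrec.fst) Primrec.snd)

/-! ### Reachability -/

theorem setOf_infinite_iff {P : ℕ → Prop} : {n | P n}.Infinite ↔ ∀ k, ∃ n, k ≤ n ∧ P n := by
  rw [← Nat.frequently_atTop_iff_infinite, Filter.frequently_atTop]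

/-- `v` is in `derive snoc S (w · u)`, where `y` is the characteristic function of `S` and `w`
that of a binary relation. -/
def DeriveRel (y w : Baire) (u v : ℕ) : Prop :=
  y v = 1 ∨ ∀ k, ∃ n, k ≤ n ∧ w (Nat.pair (snoc v n) u) = 1

/-- `w` is the characteristic function of a well-founded relation satisfying the recursion of
`earlier_iff`. -/
def IsStageRel (y w : Baire) : Prop :=
  (∀ z : Baire, ∃ n, ¬ w (Nat.pair (z (n + 1)) (z n)) = 1) ∧
    ∀ v u, w (Nat.pair v u) = 1 ↔ ∃ u', w (Nat.pair u' u) = 1 ∧ DeriveRel y w u' v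

section

variable {Γ : Type} [Ctx Γ]

theorem Def.deriveRel {y w : Γ → Baire} {u v : Γ → ℕ} (hy : RDef y) (hw : RDef w) (hu : NDef u)
    (hv : NDef v) : Def fun γ => DeriveRel (y γ) (w γ) (u γ) (v γ) :=
  Def.or (Def.eq (NDef.app hy hv) (NDef.const 1)) (Def.allN (Def.exN (Def.and
    (Def.le NDef.var0.wkN NDef.var0) (Def.eq (NDef.app hw.wkN.wkN (NDef.pair
      (NDef.comp_primrec₂ primrec₂_snoc hv.wkN.wkN NDef.var0) hu.wkN.wkN)) (NDef.const 1)))))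

theorem Def.isStageRel {y w : Γ → Baire} (hy : RDef y) (hw : RDef w) :
    Def fun γ => IsStageRel (y γ) (w γ) := by
  refine Def.and (Def.allR (Def.exN (Def.not (Def.eq (NDef.app hw.wkR.wkN (NDef.pair
    (NDef.app RDef.var0.wkN (NDef.var0.add (NDef.const 1))) (NDef.app RDef.var0.wkN NDef.var0)))
      (NDef.const 1)))))
    (Def.allN (Def.allN (Def.iff (Def.eq (NDef.app hw.wkN.wkN (NDef.pair NDef.var0.wkN NDef.var0))
      (NDef.const 1)) (Def.exN (Def.and ?_ ?_)))))
  · exact Def.eq (NDef.app hw.wkN.wkN.wkN (NDef.pair NDef.var0 NDef.var0.wkN)) (NDef.const 1)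
  · exact Def.deriveRel hy.wkN.wkN.wkN hw.wkN.wkN.wkN NDef.var0 NDef.var0.wkN.wkN

end

theorem deriveRel_charFun {S : Set ℕ} {w : Baire} {u v : ℕ} : DeriveRel (charFun S) w u v ↔
    v ∈ derive snoc S {x | w (Nat.pair x u) = 1} := by
  simp only [DeriveRel, charFun_eq_one, derive, Set.mem_union, Set.mem_ofPred_eq,
    setOf_infinite_iff]

/-- The recursion alone allows relations that stop early, even the empty one. Requiring `s` to be
derivable from its own section forces that section to be the last stage omitting `s`. -/
theorem IsStageRel.section_eq {S : Set ℕ} {w : Baire} (hw : IsStageRel (charFun S) w) {s : ℕ}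
    (hs : DeriveRel (charFun S) w s s) {D : Set ℕ} (hD : IsStage snoc S D) (hsD : s ∉ D)
    (hsDer : s ∈ derive snoc S D) : {v | w (Nat.pair v s) = 1} = D := by
  have hwf : WellFounded fun v u => w (Nat.pair v u) = 1 := by
    rw [wellFounded_iff_isEmpty_descending_chain]
    refine ⟨fun ⟨z, hz⟩ => ?_⟩
    obtain ⟨n, hn⟩ := hw.1 z
    exact hn (hz n)
  have hst := isStage_of_wellFounded (child := snoc) (S := S) hwf
    (fun v u => (hw.2 v u).trans (exists_congr fun u' => and_congr_right fun _ =>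
      deriveRel_charFun))
  exact (hst s).unique hD (fun h => hwf.irrefl.irrefl s h) (deriveRel_charFun.1 hs) hsD hsDer

open Classical in
theorem exists_isStageRel {S : Set ℕ} {s : ℕ} {D : Set ℕ} (hD : IsStage snoc S D) (hsD : s ∉ D)
    (hsDer : s ∈ derive snoc S D) :
    ∃ w : Baire, IsStageRel (charFun S) w ∧ DeriveRel (charFun S) w s s := by
  let w : Baire := fun p => if Earlier snoc S p.unpair.1 p.unpair.2 then 1 else 0
  have hw : ∀ v u, w (Nat.pair v u) = 1 ↔ Earlier snoc S v u := fun v u => by simp [w]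
  refine ⟨w, ⟨fun z => ?_, fun v u => ?_⟩, ?_⟩
  · by_contra h
    push Not at h
    exact (wellFounded_iff_isEmpty_descending_chain.1
      (wellFounded_earlier (child := snoc) (S := S))).false ⟨z, fun n => (hw _ _).1 (h n)⟩
  · simp only [deriveRel_charFun, hw]
    exact earlier_iff
  · simp only [deriveRel_charFun, hw]
    have hsub : D ⊆ {x | Earlier snoc S x s} := fun x hx => ⟨D, hD, hx, hsD⟩
    exact derive_mono hsub hsDer

/-- An infinite subset of `A` that occurs as the set of children of a node in the stage before the
node appears defines `a`. -/
theorem sigma21_of_stage {c a : Baire} {A : Set ℕ} (hA : IsCodingSet a A) {S : Set ℕ}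
    (hS : Delta21 c S) {s : ℕ} {D : Set ℕ} (hD : IsStage snoc S D) (hsD : s ∉ D)
    (hinf : {n | snoc s n ∈ D}.Infinite) {k : ℕ} (hk : ∀ n, k ≤ n → snoc s n ∈ D → n ∈ A) :
    Sigma21 c a := by
  have hsDer : s ∈ derive snoc S D := Or.inr hinf
  set B : Set ℕ := {n | k ≤ n ∧ snoc s n ∈ D} with hB
  have hBinf : B.Infinite := by
    rw [hB, setOf_infinite_iff]
    intro l
    obtain ⟨n, hn, hnD⟩ := setOf_infinite_iff.1 hinf (max k l)
    exact ⟨n, (le_max_right _ _).trans hn, (le_max_left _ _).trans hn, hnD⟩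
  have hred : (a : ℕ →. ℕ) ≤ᵀ (charFun B : ℕ →. ℕ) :=
    TuringReducible.trans hA.turingEquivalent.2 (hA.le_subset B (fun n hn => hk n hn.1 hn.2) hBinf)
  obtain ⟨R, hR, hRa⟩ := exists_pdef_of_turingReducible hred
  refine sigma21_of_delta21 hS (T := fun y n m => ∃ w : Baire, (IsStageRel y w ∧
    DeriveRel y w s s) ∧ ∃ b : Baire, (∀ i, (b i = 1 ∧ k ≤ i ∧ w (Nat.pair (snoc s i) s) = 1) ∨
      (b i = 0 ∧ ¬ (k ≤ i ∧ w (Nat.pair (snoc s i) s) = 1))) ∧ R b n m) ?_ ?_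
  · intro Γ _ y n m hy hn hm
    have hb : NDef fun p : ((Γ × Baire) × Baire) × ℕ => p.1.2 p.2 :=
      NDef.app RDef.var0.wkN NDef.var0
    have hw : Def fun p : ((Γ × Baire) × Baire) × ℕ =>
        k ≤ p.2 ∧ p.1.1.2 (Nat.pair (snoc s p.2) s) = 1 :=
      Def.and (Def.le (NDef.const k) NDef.var0) (Def.eq (NDef.app RDef.var0.wkR.wkN (NDef.pair
        (NDef.comp_primrec₂ primrec₂_snoc (NDef.const s) NDef.var0) (NDef.const s)))
          (NDef.const 1))
    exact Def.exR (Def.and (Def.and (Def.isStageRel hy.wkR RDef.var0)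
      (Def.deriveRel hy.wkR RDef.var0 (NDef.const s) (NDef.const s)))
      (Def.exR (Def.and (Def.allN (Def.or (Def.and (Def.eq hb (NDef.const 1)) hw)
        (Def.and (Def.eq hb (NDef.const 0)) hw.not))) (hR RDef.var0 hn.wkR.wkR hm.wkR.wkR))))
  · intro n m
    rw [← hRa n m]
    have hsec : ∀ w, IsStageRel (charFun S) w ∧ DeriveRel (charFun S) w s s → ∀ i,
        (w (Nat.pair (snoc s i) s) = 1 ↔ snoc s i ∈ D) := by
      rintro w ⟨hw, hw'⟩ i
      rw [← hw.section_eq hw' hD hsD hsDer]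
      rfl
    constructor
    · rintro ⟨w, hw, b, hb, hRb⟩
      have : b = charFun B := by
        funext i
        have := hb i
        rw [hsec w hw i] at this
        change (b i = 1 ∧ i ∈ B) ∨ (b i = 0 ∧ i ∉ B) at this
        by_cases hi : i ∈ B <;> simpa [charFun, hi] using this
      exact this ▸ hRb
    · intro h
      obtain ⟨w, hw⟩ := exists_isStageRel hD hsD hsDer
      refine ⟨w, hw, charFun B, fun i => ?_, h⟩
      rw [hsec w hw i]
      change (charFun B i = 1 ∧ i ∈ B) ∨ (charFun B i = 0 ∧ i ∉ B)
      by_cases hi : i ∈ B <;> simp [charFun, hi]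

/-- Unless `a ∈ Σ²₁(c)`, a determinate set of finite sequences that is met by the extensions of
`t` beyond every bound is met by an `A`-avoiding extension of `t`. -/
theorem exists_avoidExt {c a : Baire} {A : Set ℕ} (hA : IsCodingSet a A) (ha : ¬ Sigma21 c a)
    {S : Set ℕ} (hS : Delta21 c S) {t : List ℕ} {h : List ℕ → ℕ}
    (hd : ∀ h' : List ℕ → ℕ, (∀ s, h s ≤ h' s) →
      ∃ t', RightExt h' t' t ∧ Encodable.encode t' ∈ S) :
    ∃ t', RightExt h t' t ∧ AvoidExt A t' t ∧ Encodable.encode t' ∈ S := by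
  have hsnoc : ∀ (s : List ℕ) n, snoc (Encodable.encode s) n = Encodable.encode (s ++ [n]) := by
    intro s n
    simp [snoc]
  by_contra hno
  push Not at hno
  -- If such an `s` entered at the next stage through infinitely many children, then by induction
  -- those beyond `h s` would all be given by elements of `A`, and `a` would be definable.
  have avoid : ∀ D, IsStage snoc S D → ∀ s : List ℕ, RightExt h s t → AvoidExt A s t →
      Encodable.encode s ∉ D := by
    intro D hD
    induction hD with
    | mk F hF ih =>
      intro s hs hsA hmem
      obtain ⟨D, hDF, hsD⟩ := Set.mem_iUnion₂.1 hmem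
      have hnot := ih D hDF s hs hsA
      rcases hsD with hsS | hinf
      · exact hno s hs hsA hsS
      · refine ha (sigma21_of_stage hA hS (hF D hDF) hnot hinf (k := h s) fun n hn hnD => ?_)
        by_contra hnA
        rw [hsnoc] at hnD
        exact ih D hDF (s ++ [n]) ((RightExt.concat hn).trans hs fun _ => le_rfl)
          ((AvoidExt.concat hnA).trans hsA) hnD
  -- Since `t` lies outside all stages, raising `h` by this bound keeps all further extensions
  -- outside, and in particular outside `S`, against `hd`.
  obtain ⟨b, hb⟩ := exists_bound_of_notMem (child := snoc) (S := S)
  obtain ⟨t', ht', hmem⟩ := hd (fun s => max (h s) (b (Encodable.encode s)))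
    fun s => le_max_left _ _
  have stay : ∀ n ≤ t'.length, t.length ≤ n → ∀ D, IsStage snoc S D →
      Encodable.encode (t'.take n) ∉ D := by
    intro n
    induction n with
    | zero =>
      intro _ hn
      obtain rfl : t = [] := List.length_eq_zero_iff.1 (by omega)
      intro D hD
      simpa using avoid D hD [] (RightExt.refl _ _) (AvoidExt.refl _ _)
    | succ n ih =>
      intro hn hle
      rcases Nat.lt_or_ge n t.length with hlt | hge
      · have : t'.take (n + 1) = t := by
          rw [show n + 1 = t.length by omega]
          exact (List.prefix_iff_eq_take.1 ht'.1).symm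
        intro D hD
        rw [this]
        exact avoid D hD t (RightExt.refl _ _) (AvoidExt.refl _ _)
      · have hlt : n < t'.length := by omega
        have := (hb _ (ih hlt.le hge)).2 t'[n]
          ((le_max_right _ _).trans (ht'.2 n hlt hge))
        rwa [hsnoc, List.take_append_getElem] at this
  have := stay t'.length le_rfl ht'.1.length_le
  rw [List.take_length] at this
  exact (hb _ this).1 hmem

/-! ### Conditions as reals -/

/-- The condition coded by a real. -/
def condOf (y : Baire) : Cond := ⟨ofNat (List ℕ) (y 0), fun t => y (Encodable.encode t + 1)⟩

theorem condOf_surjective : Function.Surjective condOf := fun p =>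
  ⟨fun n => Nat.casesOn n (Encodable.encode p.stem) fun k => p.bound (ofNat (List ℕ) k), by
    simp [condOf]⟩

theorem condOf_le_iff {y z : Baire} : (condOf y).Le (condOf z) ↔
    (Encodable.encode ((ofNat (List ℕ) (y 0)).take (ofNat (List ℕ) (z 0)).length) = z 0 ∧
      ∀ n, n < (ofNat (List ℕ) (y 0)).length → (ofNat (List ℕ) (z 0)).length ≤ n →
        z (Encodable.encode ((ofNat (List ℕ) (y 0)).take n) + 1) ≤
          (ofNat (List ℕ) (y 0)).getD n 0) ∧
      ∀ n, z (n + 1) ≤ y (n + 1) := by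
  unfold Cond.Le RightExt condOf
  refine and_congr (and_congr ?_ (forall_congr' fun n => forall_congr' fun hn => ?_)) ?_
  · rw [List.prefix_iff_eq_take]
    constructor
    · intro h
      rw [← h, Denumerable.encode_ofNat]
    · intro h
      conv_lhs => rw [← h]
      simp
  · rw [List.getD_eq_getElem _ _ hn]
  · constructor
    · intro h n
      simpa using h (ofNat (List ℕ) n)
    · intro h t
      exact h _

section

variable {Γ : Type} [Ctx Γ]

theorem NDef.length {f : Γ → ℕ} (hf : NDef f) : NDef fun γ => (ofNat (List ℕ) (f γ)).length :=
  NDef.comp_primrec (Primrec.list_length.comp primrec_ofNat_list) hf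

theorem NDef.take {f g : Γ → ℕ} (hf : NDef f) (hg : NDef g) :
    NDef fun γ => Encodable.encode ((ofNat (List ℕ) (f γ)).take (g γ)) :=
  NDef.comp_primrec₂ (F := fun s n => Encodable.encode ((ofNat (List ℕ) s).take n))
    (Primrec.encode.comp (Primrec.list_take.comp Primrec.snd
      (primrec_ofNat_list.comp Primrec.fst))) hf hg

theorem NDef.getD {f g : Γ → ℕ} (hf : NDef f) (hg : NDef g) :
    NDef fun γ => (ofNat (List ℕ) (f γ)).getD (g γ) 0 :=
  NDef.comp_primrec₂ (F := fun s n => (ofNat (List ℕ) s).getD n 0)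
    ((Primrec.list_getD 0).comp (primrec_ofNat_list.comp Primrec.fst) Primrec.snd) hf hg

theorem Def.condLe {y z : Γ → Baire} (hy : RDef y) (hz : RDef z) :
    Def fun γ => (condOf (y γ)).Le (condOf (z γ)) := by
  have hy0 := NDef.app hy (NDef.const 0)
  have hz0 := NDef.app hz (NDef.const 0)
  refine Def.congr (Def.and (Def.and (Def.eq (NDef.take hy0 hz0.length) hz0) (Def.allN (Def.imp
    (Def.lt NDef.var0 hy0.wkN.length) (Def.imp (Def.le hz0.wkN.length NDef.var0) (Def.le
      (NDef.app hz.wkN ((NDef.take hy0.wkN NDef.var0).add (NDef.const 1)))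
      (NDef.getD hy0.wkN NDef.var0)))))) (Def.allN (Def.le
        (NDef.app hz.wkN (NDef.var0.add (NDef.const 1)))
        (NDef.app hy.wkN (NDef.var0.add (NDef.const 1)))))) fun γ => condOf_le_iff.symm

theorem Def.isPrefix {f g : Γ → ℕ} (hf : NDef f) (hg : NDef g) :
    Def fun γ => ofNat (List ℕ) (f γ) <+: ofNat (List ℕ) (g γ) := by
  refine (Def.eq (NDef.take hg hf.length) hf).congr fun γ => ?_
  rw [List.prefix_iff_eq_take]
  constructor
  · intro h
    conv_lhs => rw [← h]
    simp
  · intro h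
    rw [← h, Denumerable.encode_ofNat]

end

/-! ### The forcing relation -/

/-- The finite sequence `t` has an initial segment in the open set coded by `c`. -/
def Hits (c : Baire) (t : List ℕ) : Prop := ∃ n, c (n + 1) = 1 ∧ ofNat (List ℕ) n <+: t

/-- `c` is a code for the Borel set `B`, and `P` is the set of conditions forcing that the generic
real belongs to `B`. -/
inductive Forces : Baire → Set Baire → Set Cond → Prop
  | isOpen (c : Baire) (h : 2 ≤ c 0) :
      Forces c {x | ∃ n, c (n + 1) = 1 ∧ IsInit (ofNat (List ℕ) n) x}
        {p | ∀ q : Cond, q.Le p → ∃ r : Cond, r.Le q ∧ Hits c r.stem}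
  | compl (c : Baire) (B : Set Baire) (P : Set Cond) (h : c 0 = 0)
      (hB : Forces (fun n => c (n + 1)) B P) : Forces c Bᶜ {p | ∀ q : Cond, q.Le p → q ∉ P}
  | iUnion (c : Baire) (B : ℕ → Set Baire) (P : ℕ → Set Cond) (h : c 0 = 1)
      (hB : ∀ i, Forces (fun n => c (Nat.pair i n + 1)) (B i) (P i)) :
      Forces c (⋃ i, B i) {p | ∀ q : Cond, q.Le p → ∃ r : Cond, r.Le q ∧ ∃ i, r ∈ P i}

theorem BorelCode.exists_forces {c : Baire} {B : Set Baire} (h : BorelCode c B) :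
    ∃ P, Forces c B P := by
  induction h with
  | isOpen c h => exact ⟨_, .isOpen c h⟩
  | compl c B h _ ih =>
    obtain ⟨P, hP⟩ := ih
    exact ⟨_, .compl c B P h hP⟩
  | iUnion c B h _ ih =>
    choose P hP using ih
    exact ⟨_, .iUnion c B P h hP⟩

/-- The first digit of the code determines the clause, so the forcing set depends on the code alone
and one set `X` can serve all codes at once. -/
theorem Forces.unique {c : Baire} {B : Set Baire} {P : Set Cond} (h : Forces c B P) :
    ∀ {B' : Set Baire} {P' : Set Cond}, Forces c B' P' → P = P' := by
  induction h with
  | isOpen c h =>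
    intro B' P' h'
    cases h' with
    | isOpen => rfl
    | compl => omega
    | iUnion => omega
  | compl c B P h _ ih =>
    intro B' P' h'
    cases h' with
    | isOpen => omega
    | compl _ _ P' _ hP' => rw [ih hP']
    | iUnion => omega
  | iUnion c B P h _ ih =>
    intro B' P' h'
    cases h' with
    | isOpen => omega
    | compl => omega
    | iUnion _ _ P' _ hP' => rw [funext fun i => ih i (hP' i)]

theorem Forces.of_le {c : Baire} {B : Set Baire} {P : Set Cond} (h : Forces c B P) {p q : Cond}
    (hp : p ∈ P) (hq : q.Le p) : q ∈ P := by
  cases h <;> exact fun r hr => hp r (hr.trans hq)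

/-- This regularity removes double negations: not forcing the complement anywhere below `p` amounts
to forcing the set. -/
theorem Forces.of_dense {c : Baire} {B : Set Baire} {P : Set Cond} (h : Forces c B P) {p : Cond}
    (hp : ∀ q : Cond, q.Le p → ∃ r : Cond, r.Le q ∧ r ∈ P) : p ∈ P := by
  cases h with
  | isOpen =>
    intro q hq
    obtain ⟨r, hr, hrP⟩ := hp q hq
    obtain ⟨s, hs, hsP⟩ := hrP r (Cond.Le.refl r)
    exact ⟨s, hs.trans hr, hsP⟩
  | compl _ _ P _ hP =>
    intro q hq hqP
    obtain ⟨r, hr, hrP⟩ := hp q hq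
    exact hrP r (Cond.Le.refl r) (hP.of_le hqP hr)
  | iUnion =>
    intro q hq
    obtain ⟨r, hr, hrP⟩ := hp q hq
    obtain ⟨s, hs, hsP⟩ := hrP r (Cond.Le.refl r)
    exact ⟨s, hs.trans hr, hsP⟩

/-! ### Definability of the forcing relation -/

/-- `X` declares `c` to be a code. -/
def ValidIn (X : Set Baire) (c : Baire) : Prop := (fun n => Nat.pair 0 (c n)) ∈ X

/-- `X` declares that the condition coded by `y` forces the generic real into the set coded
by `c`. -/
def ForcedIn (X : Set Baire) (c y : Baire) : Prop := (fun n => Nat.pair (c n + 1) (y n)) ∈ X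

/-- The declarations made by `X` obey the recursive definition of the forcing relation. -/
def IsForcingRel (X : Set Baire) : Prop :=
  ∀ c : Baire, ValidIn X c →
    (2 ≤ c 0 ∧ ∀ y, ForcedIn X c y ↔ ∀ z, (condOf z).Le (condOf y) →
      ∃ r, (condOf r).Le (condOf z) ∧ Hits c (condOf r).stem) ∨
    (c 0 = 0 ∧ ValidIn X (fun n => c (n + 1)) ∧ ∀ y, ForcedIn X c y ↔
      ∀ z, (condOf z).Le (condOf y) → ¬ ForcedIn X (fun n => c (n + 1)) z) ∨
    (c 0 = 1 ∧ (∀ i, ValidIn X fun n => c (Nat.pair i n + 1)) ∧ ∀ y, ForcedIn X c y ↔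
      ∀ z, (condOf z).Le (condOf y) → ∃ r, (condOf r).Le (condOf z) ∧
        ∃ i, ForcedIn X (fun n => c (Nat.pair i n + 1)) r)

/-- `IsForcingRel` does not say that codes are well-founded, so `X` may err on false codes. On a
true code, induction along its recursion leaves no freedom. -/
theorem Forces.forcedIn_iff {c : Baire} {B : Set Baire} {P : Set Cond} (h : Forces c B P)
    {X : Set Baire} (hX : IsForcingRel X) (hc : ValidIn X c) (y : Baire) :
    ForcedIn X c y ↔ condOf y ∈ P := by
  induction h generalizing y with
  | isOpen c h =>
    rcases hX c hc with ⟨-, h'⟩ | ⟨h', -⟩ | ⟨h', -⟩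
    · simp only [h', Set.mem_ofPred_eq, condOf_surjective.forall, condOf_surjective.exists]
    · omega
    · omega
  | compl c B P h _ ih =>
    rcases hX c hc with ⟨h', -⟩ | ⟨-, hv, h'⟩ | ⟨h', -⟩
    · omega
    · simp only [h', Set.mem_ofPred_eq, condOf_surjective.forall, ih hv]
    · omega
  | iUnion c B P h _ ih =>
    rcases hX c hc with ⟨h', -⟩ | ⟨h', -⟩ | ⟨-, hv, h'⟩
    · omega
    · omega
    · simp only [h', Set.mem_ofPred_eq, condOf_surjective.forall, condOf_surjective.exists,
        ih _ (hv _)]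

theorem IsForcingRel.validIn_row {X : Set Baire} (hX : IsForcingRel X) {c : Baire}
    (hc : ValidIn X c) (h : c 0 = 1) (i : ℕ) : ValidIn X fun n => c (Nat.pair i n + 1) := by
  rcases hX c hc with ⟨hval, -⟩ | ⟨hval, -⟩ | ⟨-, hval, -⟩
  · omega
  · omega
  · exact hval i

/-- The true forcing relation obeys its recursive definition. -/
theorem exists_isForcingRel :
    ∃ X, IsForcingRel X ∧ ∀ c B P, Forces c B P → ValidIn X c := by
  -- First coordinate zero marks validity and a positive one marks forcing, so the two kinds of
  -- declarations never collide.
  let X : Set Baire := {z | (∃ c B P, Forces c B P ∧ z = fun n => Nat.pair 0 (c n)) ∨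
    ∃ c B P y, Forces c B P ∧ condOf y ∈ P ∧ z = fun n => Nat.pair (c n + 1) (y n)}
  have hvalid : ∀ c, ValidIn X c ↔ ∃ B P, Forces c B P := by
    intro c
    constructor
    · rintro (⟨c', B, P, h, he⟩ | ⟨c', B, P, y, -, -, he⟩)
      · have : c = c' := funext fun n => (Nat.pair_eq_pair.1 (congrFun he n)).2
        exact ⟨B, P, this ▸ h⟩
      · have := (Nat.pair_eq_pair.1 (congrFun he 0)).1
        omega
    · rintro ⟨B, P, h⟩
      exact Or.inl ⟨c, B, P, h, rfl⟩
  have hforced : ∀ c B P, Forces c B P → ∀ y, ForcedIn X c y ↔ condOf y ∈ P := by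
    intro c B P h y
    constructor
    · rintro (⟨c', B', P', -, he⟩ | ⟨c', B', P', y', h', hy', he⟩)
      · have := (Nat.pair_eq_pair.1 (congrFun he 0)).1
        omega
      · have hc : c = c' := funext fun n => by
          have := (Nat.pair_eq_pair.1 (congrFun he n)).1
          omega
        have hy : y = y' := funext fun n => (Nat.pair_eq_pair.1 (congrFun he n)).2
        subst hc hy
        rwa [h.unique h']
    · intro hy
      exact Or.inr ⟨c, B, P, y, h, hy, rfl⟩
  refine ⟨X, fun c hc => ?_, fun c B P h => (hvalid c).2 ⟨B, P, h⟩⟩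
  obtain ⟨B, P, h⟩ := (hvalid c).1 hc
  have hcP := hforced c B P h
  cases h with
  | isOpen _ h =>
    refine Or.inl ⟨h, fun y => ?_⟩
    simp only [hcP, Set.mem_ofPred_eq, condOf_surjective.forall, condOf_surjective.exists]
  | compl _ B P h hB =>
    refine Or.inr (Or.inl ⟨h, (hvalid _).2 ⟨_, _, hB⟩, fun y => ?_⟩)
    simp only [hcP, Set.mem_ofPred_eq, condOf_surjective.forall, hforced _ _ _ hB]
  | iUnion _ B P h hB =>
    refine Or.inr (Or.inr ⟨h, fun i => (hvalid _).2 ⟨_, _, hB i⟩, fun y => ?_⟩)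
    simp only [hcP, Set.mem_ofPred_eq, condOf_surjective.forall, condOf_surjective.exists,
      hforced _ _ _ (hB _)]

section

variable {Γ : Type} [Ctx Γ]

theorem Def.validIn {c : Γ → Baire} (hc : RDef c) : Def fun γ => ValidIn (Ctx.set γ) (c γ) :=
  Def.mem (f := fun γ n => Nat.pair 0 (c γ n)) (NDef.pair (NDef.const 0) hc)

theorem Def.forcedIn {c y : Γ → Baire} (hc : RDef c) (hy : RDef y) :
    Def fun γ => ForcedIn (Ctx.set γ) (c γ) (y γ) :=
  Def.mem (f := fun γ n => Nat.pair (c γ n + 1) (y γ n))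
    (NDef.pair (NDef.add hc (NDef.const 1)) hy)

theorem RDef.shift {c : Γ → Baire} (hc : RDef c) : RDef fun γ n => c γ (n + 1) :=
  NDef.app hc.wkN (NDef.var0.add (NDef.const 1))

theorem RDef.row {c : Γ → Baire} {i : Γ → ℕ} (hc : RDef c) (hi : NDef i) :
    RDef fun γ n => c γ (Nat.pair (i γ) n + 1) :=
  NDef.app hc.wkN ((NDef.pair hi.wkN NDef.var0).add (NDef.const 1))

theorem Def.hits {c : Γ → Baire} {s : Γ → ℕ} (hc : RDef c) (hs : NDef s) :
    Def fun γ => Hits (c γ) (ofNat (List ℕ) (s γ)) :=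
  Def.exN (Def.and (Def.eq (NDef.app hc.wkN (NDef.var0.add (NDef.const 1))) (NDef.const 1))
    (Def.isPrefix NDef.var0 hs.wkN))

theorem Def.isForcingRel : Def fun γ : Γ => IsForcingRel (Ctx.set γ) := by
  have hc : RDef fun p : Γ × Baire => p.2 := RDef.var0
  have hc0 := NDef.app hc (NDef.const 0)
  refine Def.allR (Def.imp (Def.validIn hc) (Def.or (Def.and (Def.le (NDef.const 2) hc0) ?_)
    (Def.or (Def.and (Def.eq hc0 (NDef.const 0)) (Def.and (Def.validIn hc.shift) ?_))
      (Def.and (Def.eq hc0 (NDef.const 1)) (Def.and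
        (Def.allN (Def.validIn (hc.wkN.row NDef.var0))) ?_)))))
  · exact Def.allR (Def.iff (Def.forcedIn hc.wkR RDef.var0) (Def.allR (Def.imp
      (Def.condLe RDef.var0 RDef.var0.wkR) (Def.exR (Def.and (Def.condLe RDef.var0 RDef.var0.wkR)
        (Def.hits hc.wkR.wkR.wkR (NDef.app RDef.var0 (NDef.const 0))))))))
  · exact Def.allR (Def.iff (Def.forcedIn hc.wkR RDef.var0) (Def.allR (Def.imp
      (Def.condLe RDef.var0 RDef.var0.wkR) (Def.not (Def.forcedIn hc.wkR.wkR.shift RDef.var0)))))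
  · exact Def.allR (Def.iff (Def.forcedIn hc.wkR RDef.var0) (Def.allR (Def.imp
      (Def.condLe RDef.var0 RDef.var0.wkR) (Def.exR (Def.and (Def.condLe RDef.var0 RDef.var0.wkR)
        (Def.exN (Def.forcedIn (RDef.row hc.wkR.wkR.wkR.wkN NDef.var0) RDef.var0.wkN)))))))

end

/-- A set that is definable from the forcing relation for a code definable from `c`. -/
theorem Forces.delta21 {c d : Baire} {B : Set Baire} {P : Set Cond} (h : Forces d B P)
    (hd : RDef fun _ : CtxOf c => d) {S : Set ℕ} {Q : CtxOf c → ℕ → Prop}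
    (hQ : Def fun p : CtxOf c × ℕ => Q p.1 p.2)
    (hS : ∀ X : CtxOf c, IsForcingRel X → ValidIn X d → ∀ n, Q X n ↔ n ∈ S) : Delta21 c S := by
  obtain ⟨X, hX, hval⟩ := exists_isForcingRel
  exact ⟨fun X => IsForcingRel X ∧ ValidIn X d, Q, Def.and Def.isForcingRel (Def.validIn hd), hQ,
    ⟨X, hX, hval _ _ _ h⟩, fun X hX => hS X hX.1 hX.2⟩

/-! ### From forcing to ensuring -/

theorem exists_cond_iff {P : Set Cond} {n : ℕ} :
    (∃ h, (⟨ofNat (List ℕ) n, h⟩ : Cond) ∈ P) ↔ ∃ y : Baire, y 0 = n ∧ condOf y ∈ P := by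
  constructor
  · rintro ⟨h, hP⟩
    obtain ⟨y, hy⟩ := condOf_surjective ⟨ofNat (List ℕ) n, h⟩
    refine ⟨y, ?_, hy ▸ hP⟩
    have := congrArg (fun p : Cond => Encodable.encode p.stem) hy
    simpa [condOf] using this
  · rintro ⟨y, rfl, hy⟩
    exact ⟨_, hy⟩

/-- The reachability property for a set `P` of conditions that is dense below `q` and whose set of
stems is determinate. -/
theorem exists_leA_mem {c a : Baire} {A : Set ℕ} (hA : IsCodingSet a A) (ha : ¬ Sigma21 c a)
    {P : Set Cond} (hdown : ∀ p q : Cond, p ∈ P → q.Le p → q ∈ P)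
    (hP : Delta21 c {n | ∃ h, (⟨ofNat (List ℕ) n, h⟩ : Cond) ∈ P}) {q : Cond}
    (hd : ∀ q' : Cond, q'.Le q → ∃ r : Cond, r.Le q' ∧ r ∈ P) :
    ∃ r : Cond, r.LeA A q ∧ r ∈ P := by
  have key := exists_avoidExt hA ha hP (t := q.stem) (h := q.bound) ?_
  · obtain ⟨t, ht, htA, hmem⟩ := key
    obtain ⟨h, hh⟩ := hmem
    rw [Denumerable.ofNat_encode] at hh
    -- Reachability controls stems only; taking the maximum of the bounds gives an extension of `q`
    -- that also lies below the member of `P` with this stem.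
    refine ⟨⟨t, fun s => max (q.bound s) (h s)⟩, ⟨ht, htA, fun s => le_max_left _ _⟩,
      hdown _ _ hh ⟨RightExt.refl _ _, fun s => le_max_right _ _⟩⟩
  · intro h' hh'
    obtain ⟨r, hr, hrP⟩ := hd ⟨q.stem, h'⟩ ⟨RightExt.refl _ _, hh'⟩
    exact ⟨r.stem, hr.1, r.bound, by simpa using hrP⟩

/-- A cofinite `A` contains a final segment of `ω`, and `a` would be computable from that. -/
theorem infinite_compl_of_not_sigma21 {c a : Baire} {A : Set ℕ} (hA : IsCodingSet a A)
    (ha : ¬ Sigma21 c a) : Aᶜ.Infinite := by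
  intro hfin
  obtain ⟨k, hk⟩ := hfin.bddAbove
  have hsub : {n | k + 1 ≤ n} ⊆ A := by
    intro n hn
    by_contra hnA
    have := hk hnA
    simp only [Set.mem_ofPred_eq] at hn
    omega
  have hinf : {n | k + 1 ≤ n}.Infinite :=
    setOf_infinite_iff.2 fun l => ⟨max l (k + 1), le_max_left _ _, le_max_right _ _⟩
  obtain ⟨R, hR, hRa⟩ := exists_pdef_of_turingReducible
    (TuringReducible.trans hA.turingEquivalent.2 (hA.le_subset _ hsub hinf))
  refine ha (sigma21_of_delta21 (S := {n | k + 1 ≤ n}) ?_ hR hRa)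
  exact ⟨fun _ => (0 : ℕ) = 0, fun _ n => k + 1 ≤ n, Def.eq (NDef.const 0) (NDef.const 0),
    Def.le (NDef.const _) NDef.var0, ⟨(∅ : Set Baire), rfl⟩, fun _ _ _ => Iff.rfl⟩

/-- Membership and non-membership are treated together, because complementation exchanges them. -/
theorem Forces.ensuresSet {c a : Baire} {A : Set ℕ} (hA : IsCodingSet a A) (ha : ¬ Sigma21 c a)
    {d : Baire} {B : Set Baire} {P : Set Cond} (h : Forces d B P)
    (hd : RDef fun _ : CtxOf c => d) (p : Cond) :
    (p ∈ P → EnsuresSet A p B) ∧ ((∀ q : Cond, q.Le p → q ∉ P) → EnsuresSet A p Bᶜ) := by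
  have hAc := infinite_compl_of_not_sigma21 hA ha
  induction h generalizing p with
  | isOpen d h =>
    have hup : ∀ {s t : List ℕ}, Hits d s → s <+: t → Hits d t :=
      fun ⟨n, hn, hs⟩ hst => ⟨n, hn, hs.trans hst⟩
    constructor
    · intro hp
      refine EnsuresSet.of_dense fun q hq => ?_
      have key := exists_leA_mem hA ha (P := {r | Hits d r.stem}) (q := q)
        (fun p q hp hq => hup hp hq.1.1) ?_ (fun q' hq' => hp q' (hq'.trans hq))
      · obtain ⟨r, hr, hrP⟩ := key
        refine ⟨r, hr, (ensuresSet_rightExt hAc r).mono ?_⟩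
        rintro x ⟨u, hu, hlen⟩
        obtain ⟨n, hn, hpre⟩ := hrP
        exact ⟨n, hn, (hu 0).2.of_prefix (hpre.trans (hu 0).1.1)⟩
      · refine ⟨fun _ => (0 : ℕ) = 0, fun _ n => Hits d (ofNat (List ℕ) n),
          Def.eq (NDef.const 0) (NDef.const 0), Def.hits hd.wkN NDef.var0,
          ⟨(∅ : Set Baire), rfl⟩, fun _ _ n => ?_⟩
        exact ⟨fun h => ⟨fun _ => 0, h⟩, fun ⟨_, h⟩ => h⟩
    · intro hp
      refine (ensuresSet_rightExt hAc p).mono ?_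
      rintro x ⟨u, hu, hlen⟩ ⟨n, hn, hx⟩
      obtain ⟨k, hk⟩ := hlen (ofNat (List ℕ) n).length
      have hhit : Hits d (u k) := ⟨n, hn, hx.prefix (hu k).2 hk⟩
      -- A result in the open set would already meet it at a finite stem, and that stem with the
      -- bound of `p` would be a condition below `p` forcing the open set.
      refine hp ⟨u k, p.bound⟩ ⟨(hu k).1, fun _ => le_rfl⟩ fun q hq => ⟨q, Cond.Le.refl q, ?_⟩
      exact hup hhit hq.1.1
  | compl d B P h hB ih =>
    have ih := ih hd.shift
    refine ⟨fun hp => (ih p).2 hp, fun hp => ?_⟩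
    rw [compl_compl]
    refine (ih p).1 (hB.of_dense fun q hq => ?_)
    have := hp q hq
    simp only [Set.mem_ofPred_eq, not_forall, not_not] at this
    obtain ⟨r, hr, hrP⟩ := this
    exact ⟨r, hr, hrP⟩
  | iUnion d B P h hB ih =>
    have hrow : ∀ i, RDef fun _ : CtxOf c => fun n => d (Nat.pair i n + 1) :=
      fun i => hd.row (NDef.const i)
    have ih := fun i => ih i (hrow i)
    constructor
    · intro hp
      refine EnsuresSet.of_dense fun q hq => ?_
      have key := exists_leA_mem hA ha (P := {r | ∃ i, r ∈ P i}) (q := q)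
        (fun p q ⟨i, hp⟩ hq => ⟨i, (hB i).of_le hp hq⟩) ?_ (fun q' hq' => hp q' (hq'.trans hq))
      · obtain ⟨r, hr, i, hi⟩ := key
        exact ⟨r, hr, ((ih i r).1 hi).mono (Set.subset_iUnion B i)⟩
      · refine (Forces.iUnion d B P h hB).delta21 hd (Q := fun X n => ∃ y : Baire, y 0 = n ∧
          ∃ i, ForcedIn X (fun n => d (Nat.pair i n + 1)) y) ?_ ?_
        · exact Def.exR (Def.and (Def.eq (NDef.app RDef.var0 (NDef.const 0)) NDef.var0.wkR)
            (Def.exN (Def.forcedIn (Γ := ((CtxOf c × ℕ) × Baire) × ℕ)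
              (RDef.row hd.wkN.wkR.wkN NDef.var0) RDef.var0.wkN)))
        · intro X hX hval n
          refine Iff.trans ?_ exists_cond_iff.symm
          refine exists_congr fun y => and_congr_right fun _ => exists_congr fun i => ?_
          exact (hB i).forcedIn_iff hX (hX.validIn_row hval h i) y
    · intro hp
      rw [Set.compl_iUnion]
      -- Every extension of `p` still forces the complement of each `B i`, so the games can be
      -- opened without extending further.
      refine EnsuresSet.iInter fun q hq i => ⟨q, Cond.LeA.refl _ _, (ih i q).2 fun r hr hrP => ?_⟩
      refine hp r (hr.trans hq) fun s hs => ⟨s, Cond.Le.refl s, i, (hB i).of_le hrP hs⟩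

/-- The conditions deciding `j` are dense and their stems are determinate, so an `A`-avoiding
extension decides `j`; what it forces it also ensures. -/
theorem exists_ensures {c a : Baire} {A : Set ℕ} (hA : IsCodingSet a A) (ha : ¬ Sigma21 c a)
    {d : Baire} {j : Baire → Fin 2} (hd : RDef fun _ : CtxOf c => d) (hj : IsCodeTwo d j)
    (p : Cond) : ∃ (m : Fin 2) (p' : Cond), p'.LeA A p ∧ Ensures A p' j m := by
  obtain ⟨P, hP⟩ := BorelCode.exists_forces hj
  have key := exists_leA_mem hA ha
    (P := {r | r ∈ P ∨ ∀ q : Cond, q.Le r → q ∉ P}) (q := p) ?_ ?_ ?_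
  · obtain ⟨r, hr, h | h⟩ := key
    · exact ⟨1, r, hr, (hP.ensuresSet hA ha hd r).1 h⟩
    · refine ⟨0, r, hr, ((hP.ensuresSet hA ha hd r).2 h).mono fun x hx => ?_⟩
      simp only [Set.mem_compl_iff, Set.mem_ofPred_eq] at hx ⊢
      exact (Fin.forall_fin_two.2 ⟨Or.inl rfl, Or.inr rfl⟩ : ∀ i : Fin 2, i = 0 ∨ i = 1) (j x)
        |>.resolve_right hx
  · rintro p q (h | h) hq
    · exact Or.inl (hP.of_le h hq)
    · exact Or.inr fun r hr => h r (hr.trans hq)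
  · refine hP.delta21 hd (Q := fun X n => ∃ y : Baire, y 0 = n ∧ (ForcedIn X d y ∨
      ∀ z, (condOf z).Le (condOf y) → ¬ ForcedIn X d z)) ?_ ?_
    · exact Def.exR (Def.and (Def.eq (NDef.app RDef.var0 (NDef.const 0)) NDef.var0.wkR)
        (Def.or (Def.forcedIn (Γ := (CtxOf c × ℕ) × Baire) hd.wkN.wkR RDef.var0) (Def.allR
          (Def.imp (Def.condLe RDef.var0 RDef.var0.wkR) (Def.not
            (Def.forcedIn (Γ := ((CtxOf c × ℕ) × Baire) × Baire) hd.wkN.wkR.wkR RDef.var0))))))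
    · intro X hX hval n
      refine Iff.trans ?_ exists_cond_iff.symm
      refine exists_congr fun y => and_congr_right fun _ => ?_
      simp only [hP.forcedIn_iff hX hval, Set.mem_ofPred_eq, condOf_surjective.forall]
  · intro q _
    by_cases h : ∃ r : Cond, r.Le q ∧ r ∈ P
    · obtain ⟨r, hr, hrP⟩ := h
      exact ⟨r, hr, Or.inl hrP⟩
    · push Not at h
      exact ⟨q, Cond.Le.refl q, Or.inr h⟩

theorem RDef.ctxOf (c : Baire) : RDef fun _ : CtxOf c => c :=
  NDef.of_term (.app 0 (.var 0)) fun _ => rfl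

theorem RDef.of_turingReducible {c d : Baire} (h : (d : ℕ →. ℕ) ≤ᵀ (c : ℕ →. ℕ)) :
    RDef fun _ : CtxOf c => d := by
  obtain ⟨R, hR, hRd⟩ := exists_pdef_of_turingReducible h
  exact (hR (RDef.ctxOf c).wkN.wkN NDef.var0.wkN NDef.var0).congr fun p => hRd _ _

end Encoding

open Encoding in
theorem mainTheorem4
    (a : Baire) (A : Set ℕ) (hA : IsCodingSet a A)
    (η : A → Fin 2) (hη : ∀ m, {n | η n = m}.Infinite)
    (f : Baire → Cantor) (hf : IsEncodingFun A η f)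
    (g : Baire → Cantor) (c : Baire) (hc : IsCode c g) :
    ((∀ (i : ℕ) (p : Cond), ∃ (m : Fin 2) (p' : Cond),
        p'.LeA A p ∧ Ensures A p' (fun x => g x i) m) →
      ∃ x, f x = g x) ∧
    (¬ Sigma21 c a →
      ∀ (d : Baire) (j : Baire → Fin 2),
        (d : ℕ →. ℕ) ≤ᵀ (c : ℕ →. ℕ) → IsCodeTwo d j →
        ∀ p : Cond, ∃ (m : Fin 2) (p' : Cond), p'.LeA A p ∧ Ensures A p' j m) ∧
    (¬ Sigma21 c a → ∃ x, f x = g x) ∧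
    ((∀ x, f x ≠ g x) → Sigma21 c a) := by
  have main : ¬ Sigma21 c a → ∃ x, f x = g x := fun ha =>
    exists_eq_of_ensures hη hf fun i p => exists_ensures hA ha
      (d := fun n => c (Nat.pair i n))
      (NDef.app (RDef.ctxOf c).wkN (NDef.pair (NDef.const i) NDef.var0)) (hc i) p
  refine ⟨exists_eq_of_ensures hη hf,
    fun ha d j hd hj p => exists_ensures hA ha (RDef.of_turingReducible hd) hj p, main,
    fun h => ?_⟩
  by_contra ha
  obtain ⟨x, hx⟩ := main ha
  exact h x hx
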